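/- Let $\lambda>0$, $\mathscr C\in(-1,0)\cup(0,1)$, $s_1\in\mathbb R$ and $s_2,s_3\in(0,2)$, and assume $s_3\le s_3^\star(s_2)$, where $$s_3^\star(s)=1+\frac{\sqrt{(s^2-8s+8)^2+4s^2(2-s)^2}-2s(2-s)}{s^2-8s+8}\quad(s\neq 4-2\sqrt2),\qquad s_3^\star(4-2\sqrt2)=1 .$$ *The scheme.* Let $c_1=0$, $c_2=1$, $c_3=-1$, let $M=\begin{pmatrix}1&1&1\\0&1&-1\\0&1&1\end{pmatrix}$, $\epsilon=(1,\mathscr C,\mathscr C^2)^{\mathsf T}$ and $K=I+\mathrm{diag}(s_1,s_2,s_3)(\epsilon e_1^{\mathsf T}-I)$. For a boundary source $(g^n)_{n\in\mathbb N}$ in $\mathbb R$, let $m_j^n\in\mathbb R^3$ ($n,j\in\mathbb N$) be given by $m_j^0=0$, $f_j^{n\star}=M^{-1}Km_j^n$, $m_j^{n+1}=Mf_j^{n+1}$ and $f_{i,j}^{n+1}=f^{n\star}_{i,j-c_i}$ for $i=1,2,3$, where the ghost value $f_{2,-1}^{n\star}$ is one of - bounce-back: $f_{3,0}^{n\star}+g^n$;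 - anti-bounce-back: $-f_{3,0}^{n\star}+g^n$; - two-steps anti-bounce-back: $-f_{1,0}^{n\star}-f_{3,1}^{n\star}+g^n$; - extrapolation of order $\sigma\ge1$: $\sum_{j=0}^{\sigma-1}(-1)^j\binom{\sigma}{j+1}f_{2,j}^{n\star}+g^n$; - kinetic Dirichlet: $g^n$. *Stability.* The scheme is strongly stable (SS) if there is a constant $c>0$ such that for all $\alpha>0$, all $\Delta x>0$ with $\Delta t=\Delta x/\lambda$, and all $(g^n)_{n\in\mathbb N}$, $$\frac{\alpha}{1+\alpha\Delta t}\sum_{n\ge0}\sum_{j\ge0}\Delta t\,\Delta x\,e^{-2\alpha n\Delta t}|m_j^n|^2\le c\sum_{n\ge0}\Delta t\,e^{-2\alpha n\Delta t}(g^n)^2$$ (sums in $[0,\infty]$), and strongly stable on the observed output (SSOO) if the same holds with $(m_{1,j}^n)^2$ in place of $|m_j^n|^2$. *Critical pairs.* Let $\hat E(\kappa)=M\,\mathrm{diag}(1,\kappa^{-1},\kappa)M^{-1}K$, and let $\hat B(\kappa)$ be the matrix such that, without source, $m_j^n=\kappa^j\varphi$ for all $j\ge0$ gives $m_0^{n+1}=\hat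 B(\kappa)\varphi$. Let $d_{-1}(z)+d_0(z)\kappa+d_1(z)\kappa^2$ be the polynomial in $\kappa$ that equals $\kappa\det(zI-\hat E(\kappa))$ for $\kappa\ne0$; its root $\kappa_{\mathrm s}(z)$ in the open unit disk, for $|z|>1$, is the stable root. A pair $(z,\kappa)\in\mathbb C^2$ is critical if either $|z|>1$ and $|\kappa|<1$, or $|z|=1$, $|\kappa|\le1$ and, as $w\to z$ with $|w|>1$, the stable root $\kappa_{\mathrm s}(w)$ exists, is unique, and tends to $\kappa$; and if moreover there is $\varphi\in\mathbb C^3\smallsetminus\{0\}$ with $\kappa(zI-\hat E(\kappa))\varphi=0$ (a polynomial expression in $\kappa$, also used at $\kappa=0$) and $(zI-\hat B(\kappa))\varphi=0$. The scheme is MU-L (respectively MU-E) if it is neither SS nor SSOO, a critical pair exists, and every critical pair satisfies $|z|=1$ and $|\kappa|<1$ (respectively $|z|=1$ and $|\kappa|=1$). **Theorem.** The following holds. - If $\mathscr C<0$ (outflow): bounce-back is MU-L; anti-bounce-back, two-steps anti-bounce-back, extrapolation of order $\sigma$ for each $1\le\sigma\le4$, and kinetic Dirichlet are SS. - If $\mathscr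 C>0$ (inflow): bounce-back, anti-bounce-back, two-steps anti-bounce-back and kinetic Dirichlet are SS; extrapolation of order $\sigma$ for each $1\le\sigma\le4$ is MU-E. -/

import Mathlib

noncomputable section

namespace D1Q3

open Matrix Filter Topology
open scoped ENNReal

/-! The distribution functions and the moments are indexed by `Fin 3`: the indices `0, 1, 2` here
are the indices `1, 2, 3` of the usual numbering. -/

/-- The discrete velocities `c₁ = 0`, `c₂ = 1`, `c₃ = -1`. -/
def velocity : Fin 3 → ℤ := ![0, 1, -1]

/-- The moment matrix `M`, with `m = M f`. -/
def momentMatrix : Matrix (Fin 3) (Fin 3) ℝ :=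
  !![1, 1, 1;
     0, 1, -1;
     0, 1, 1]

/-- The equilibrium vector `ε = (1, C, C²)`: the equilibria are `m^eq(m₁) = ε m₁`. -/
def equilibrium (C : ℝ) : Fin 3 → ℝ := ![1, C, C ^ 2]

/-- The relaxation matrix on the moments, `K = I + diag(s) (ε e₁ᵀ - I)`. -/
def relaxation (C : ℝ) (s : Fin 3 → ℝ) : Matrix (Fin 3) (Fin 3) ℝ :=
  1 + diagonal s * (vecMulVec (equilibrium C) (Pi.single 0 1) - 1)

/-- The matrix `M⁻¹ K`, which sends the moments at a grid point to the post-relaxation distribution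
functions `f⋆` at this point. -/
def postRelaxation (C : ℝ) (s : Fin 3 → ℝ) : Matrix (Fin 3) (Fin 3) ℝ :=
  momentMatrix⁻¹ * relaxation C s

/-- A linear kinetic boundary condition. The only distribution function missing at the boundary is
the one with velocity `+1`, at the ghost point `x₋₁`; it is filled with
`∑ ℓ, ∑ h < width, weight ℓ h * f⋆ ℓ h + g`. -/
structure BoundaryCondition where
  /-- the number of inner grid points `x₀, x₁, …` that are used -/
  width : ℕ
  /-- `weight ℓ h` multiplies the `ℓ`-th post-relaxation distribution function at `x_h` -/
  weight : Fin 3 → ℕ → ℝ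

/-- The value put at the ghost point, out of post-relaxation data `f j i` (grid point `j`,
distribution function `i`) and of the source `g`. -/
def BoundaryCondition.ghost (bc : BoundaryCondition) (f : ℕ → Fin 3 → ℝ) (g : ℝ) : ℝ :=
  ∑ ℓ : Fin 3, ∑ h ∈ Finset.range bc.width, bc.weight ℓ h * f h ℓ + g

/-- Bounce-back. -/
def bounceBack : BoundaryCondition := ⟨1, fun ℓ _ => if ℓ = 2 then 1 else 0⟩

/-- Anti-bounce-back. -/
def antiBounceBack : BoundaryCondition := ⟨1, fun ℓ _ => if ℓ = 2 then -1 else 0⟩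

/-- Two-steps anti-bounce-back. -/
def twoStepsAntiBounceBack : BoundaryCondition :=
  ⟨2, fun ℓ h => if ℓ = 0 ∧ h = 0 then -1 else if ℓ = 2 ∧ h = 1 then -1 else 0⟩

/-- Extrapolation of order `σ`. -/
def extrapolation (σ : ℕ) : BoundaryCondition :=
  ⟨σ, fun ℓ h => if ℓ = 1 then (-1) ^ h * (σ.choose (h + 1) : ℝ) else 0⟩

/-- Kinetic Dirichlet. -/
def kineticDirichlet : BoundaryCondition := ⟨0, fun _ _ => 0⟩

theorem ghost_bounceBack (f : ℕ → Fin 3 → ℝ) (g : ℝ) :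
    bounceBack.ghost f g = f 0 2 + g := by
  simp [BoundaryCondition.ghost, bounceBack]

theorem ghost_antiBounceBack (f : ℕ → Fin 3 → ℝ) (g : ℝ) :
    antiBounceBack.ghost f g = -f 0 2 + g := by
  simp [BoundaryCondition.ghost, antiBounceBack]

theorem ghost_twoStepsAntiBounceBack (f : ℕ → Fin 3 → ℝ) (g : ℝ) :
    twoStepsAntiBounceBack.ghost f g = -f 0 0 - f 1 2 + g := by
  simp [BoundaryCondition.ghost, twoStepsAntiBounceBack, Fin.sum_univ_three,
    Finset.sum_range_succ]
  ring

theorem ghost_extrapolation (σ : ℕ) (f : ℕ → Fin 3 → ℝ) (g : ℝ) :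
    (extrapolation σ).ghost f g
      = ∑ h ∈ Finset.range σ, (-1) ^ h * (σ.choose (h + 1) : ℝ) * f h 1 + g := by
  simp [BoundaryCondition.ghost, extrapolation]

theorem ghost_kineticDirichlet (f : ℕ → Fin 3 → ℝ) (g : ℝ) :
    kineticDirichlet.ghost f g = g := by
  simp [BoundaryCondition.ghost, kineticDirichlet]

/-- One time step on the half-line `j ∈ ℕ`, written on the moments: relaxation at each grid point,
then transport `f_{i,j} = f⋆_{i, j - c_i}`, where data from outside the domain come from the ghost
point. -/
def step (C : ℝ) (s : Fin 3 → ℝ) (bc : BoundaryCondition) (g : ℝ) (m : ℕ → Fin 3 → ℝ) :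
    ℕ → Fin 3 → ℝ :=
  let f : ℕ → Fin 3 → ℝ := fun j => postRelaxation C s *ᵥ m j
  fun j => momentMatrix *ᵥ fun i =>
    if velocity i ≤ (j : ℤ) then f ((j : ℤ) - velocity i).toNat i else bc.ghost f g

/-- The numerical solution `m n j i` (time step `n`, grid point `j`, moment `i`) with zero initial
data and boundary source `g n`. -/
def moments (C : ℝ) (s : Fin 3 → ℝ) (bc : BoundaryCondition) (g : ℕ → ℝ) :
    ℕ → ℕ → Fin 3 → ℝ
  | 0 => fun _ _ => 0
  | n + 1 => step C s bc (g n) (moments C s bc g n)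

/-- The stability estimate for the output `N`, a function of the vector of moments at a point:
there is a constant `K > 0` such that, for all `α > 0`, `Δx > 0` and all sources `g`, with
`Δt = Δx / lam`,
`α / (1 + α Δt) ∑ₙ ∑ⱼ Δt Δx e^(-2 α n Δt) N(mⱼⁿ) ≤ K ∑ₙ Δt e^(-2 α n Δt) (gⁿ)²`,
the sums having values in `[0, ∞]`. -/
def StabilityEstimate (N : (Fin 3 → ℝ) → ℝ) (lam C : ℝ) (s : Fin 3 → ℝ)
    (bc : BoundaryCondition) : Prop :=
  ∃ K : ℝ, 0 < K ∧ ∀ α : ℝ, 0 < α → ∀ Δx : ℝ, 0 < Δx → ∀ Δt : ℝ, Δt = Δx / lam →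
    ∀ g : ℕ → ℝ,
      ENNReal.ofReal (α / (1 + α * Δt)) *
          ∑' n : ℕ, ∑' j : ℕ, ENNReal.ofReal
            (Δt * Δx * Real.exp (-2 * α * n * Δt) * N (moments C s bc g n j))
        ≤ ENNReal.ofReal K *
          ∑' n : ℕ, ENNReal.ofReal (Δt * Real.exp (-2 * α * n * Δt) * g n ^ 2)

/-- Strong stability: all the moments are controlled. -/
def StronglyStable (lam C : ℝ) (s : Fin 3 → ℝ) (bc : BoundaryCondition) : Prop :=
  StabilityEstimate (fun m => ∑ i, m i ^ 2) lam C s bc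

/-- Strong stability on the observed output: the conserved moment `m₁` is controlled. -/
def StronglyStableObserved (lam C : ℝ) (s : Fin 3 → ℝ) (bc : BoundaryCondition) : Prop :=
  StabilityEstimate (fun m => m 0 ^ 2) lam C s bc

/-- A real matrix seen as a complex one. -/
def toComplex (A : Matrix (Fin 3) (Fin 3) ℝ) : Matrix (Fin 3) (Fin 3) ℂ := A.map Complex.ofReal

/-- The amplification matrix `Ê(κ) = M diag(κ^(-c_i)) M⁻¹ K` of the bulk scheme, for `κ ≠ 0`. -/
def bulkSymbol (C : ℝ) (s : Fin 3 → ℝ) (κ : ℂ) : Matrix (Fin 3) (Fin 3) ℂ :=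
  toComplex momentMatrix * diagonal (fun i => κ ^ (-velocity i)) * toComplex (postRelaxation C s)

/-- The matrix polynomial `κ (z I - Ê(κ))` in `κ` of the bulk scheme. -/
def bulkPencil (C : ℝ) (s : Fin 3 → ℝ) (z κ : ℂ) : Matrix (Fin 3) (Fin 3) ℂ :=
  (z * κ) • 1 - toComplex momentMatrix * diagonal (fun i => κ ^ (1 - velocity i).toNat) *
    toComplex (postRelaxation C s)

theorem bulkPencil_eq (C : ℝ) (s : Fin 3 → ℝ) (z : ℂ) {κ : ℂ} (hκ : κ ≠ 0) :
    bulkPencil C s z κ = κ • (z • 1 - bulkSymbol C s κ) := by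
  have h : (diagonal (fun i => κ ^ (1 - velocity i).toNat) : Matrix (Fin 3) (Fin 3) ℂ)
      = κ • diagonal (fun i => κ ^ (-velocity i)) := by
    ext i j
    fin_cases i <;> fin_cases j <;> simp [velocity, diagonal, hκ, pow_two]
  rw [bulkPencil, bulkSymbol, h, smul_sub, smul_smul, mul_comm z κ]
  simp

/-- The symbol `∑ ℓ, B_{0,ℓ} κ^ℓ` of the scheme at the boundary point `x₀`: the distribution
functions with velocities `0` and `-1` come from inside the domain, the one with velocity `+1` comes
from the ghost point. -/
def boundarySymbol (C : ℝ) (s : Fin 3 → ℝ) (bc : BoundaryCondition) (κ : ℂ) :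
    Matrix (Fin 3) (Fin 3) ℂ :=
  toComplex momentMatrix *
    (of fun i k => if velocity i ≤ 0 then (if i = k then κ ^ (-velocity i).toNat else 0)
      else ∑ h ∈ Finset.range bc.width, (bc.weight k h : ℂ) * κ ^ h) *
    toComplex (postRelaxation C s)

/-- The characteristic equation in the polynomial form `d₁(z) κ² + d₀(z) κ + d₋₁(z)`, that is
`κ det(z I - Ê(κ))` with its value at `κ = 0` given by continuity. -/
def characteristic (C : ℝ) (s : Fin 3 → ℝ) (z κ : ℂ) : ℂ :=
  (z • diagonal ![1, κ, 1] -
    diagonal ![1, 1, κ] * toComplex (postRelaxation C s * momentMatrix)).det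

theorem toComplex_mul (A B : Matrix (Fin 3) (Fin 3) ℝ) :
    toComplex (A * B) = toComplex A * toComplex B :=
  Matrix.map_mul (f := Complex.ofRealHom)

theorem isUnit_det_toComplex_momentMatrix : IsUnit (toComplex momentMatrix).det := by
  have : (toComplex momentMatrix).det = 2 := by
    simp [toComplex, momentMatrix, det_fin_three]
    norm_num
  rw [this]
  exact isUnit_iff_ne_zero.2 two_ne_zero

theorem characteristic_eq (C : ℝ) (s : Fin 3 → ℝ) (z : ℂ) {κ : ℂ} (hκ : κ ≠ 0) :
    characteristic C s z κ = κ * (z • 1 - bulkSymbol C s κ).det := by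
  have hM := isUnit_det_toComplex_momentMatrix
  set M := toComplex momentMatrix with hMdef
  set A := toComplex (postRelaxation C s) with hA
  have h1 : z • 1 - bulkSymbol C s κ
      = M * (z • 1 - diagonal (fun i => κ ^ (-velocity i)) * (A * M)) * M⁻¹ := by
    rw [bulkSymbol, Matrix.mul_sub, Matrix.sub_mul, Matrix.mul_smul, Matrix.mul_one,
      Matrix.smul_mul, Matrix.mul_nonsing_inv M hM]
    simp only [Matrix.mul_assoc, Matrix.mul_nonsing_inv M hM, Matrix.mul_one, ← hMdef, ← hA]
  have h2 : z • diagonal ![1, κ, 1] - diagonal ![1, 1, κ] * (A * M)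
      = diagonal ![1, κ, 1] * (z • 1 - diagonal (fun i => κ ^ (-velocity i)) * (A * M)) := by
    have : diagonal ![1, κ, 1] * diagonal (fun i => κ ^ (-velocity i)) = diagonal ![1, 1, κ] := by
      rw [diagonal_mul_diagonal]
      congr 1
      ext i
      fin_cases i <;> simp [velocity, hκ]
    rw [Matrix.mul_sub, Matrix.mul_smul, Matrix.mul_one, ← Matrix.mul_assoc (diagonal ![1, κ, 1]),
      this]
  rw [characteristic, toComplex_mul, h1, ← hMdef, ← hA, h2, det_mul, det_diagonal,
    det_conj ((isUnit_iff_isUnit_det M).2 hM)]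
  simp [Fin.prod_univ_three]

/-- The domain `|z| > 1`. -/
def outside : Set ℂ := {z | 1 < ‖z‖}

/-- `κ` is a stable root at `z`: a root in the open unit disk of the characteristic equation. -/
def IsStableRoot (C : ℝ) (s : Fin 3 → ℝ) (z κ : ℂ) : Prop :=
  ‖κ‖ < 1 ∧ characteristic C s z κ = 0

/-- Near `z₀`, the stable root is a well-defined function on `|z| > 1`, and tends to `κ₀` at
`z₀`. -/
def StableRootTendsto (C : ℝ) (s : Fin 3 → ℝ) (z₀ κ₀ : ℂ) : Prop :=
  ∃ κs : ℂ → ℂ, (∀ᶠ z in 𝓝[outside] z₀, ∀ κ, IsStableRoot C s z κ ↔ κ = κs z) ∧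
    Tendsto κs (𝓝[outside] z₀) (𝓝 κ₀)

/-- Eigenvalues `(z, κ)` shared by the bulk and the boundary scheme. -/
def IsSharedEigenvalue (C : ℝ) (s : Fin 3 → ℝ) (bc : BoundaryCondition) (z κ : ℂ) : Prop :=
  (1 < ‖z‖ ∧ ‖κ‖ < 1 ∨ ‖z‖ = 1 ∧ ‖κ‖ ≤ 1 ∧ StableRootTendsto C s z κ) ∧
    (bulkPencil C s z κ).det = 0 ∧ (z • 1 - boundarySymbol C s bc κ).det = 0

/-- Critical pairs: shared eigenvalues for which the bulk and the boundary scheme also share an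
eigenvector `φ` (the Kreiss-Lopatinskii condition fails), so that `mⱼⁿ = zⁿ κʲ φ` solves the scheme
without source. -/
def IsCritical (C : ℝ) (s : Fin 3 → ℝ) (bc : BoundaryCondition) (z κ : ℂ) : Prop :=
  IsSharedEigenvalue C s bc z κ ∧
    ∃ φ : Fin 3 → ℂ, φ ≠ 0 ∧ bulkPencil C s z κ *ᵥ φ = 0 ∧
      (z • 1 - boundarySymbol C s bc κ) *ᵥ φ = 0

/-- MU-L: mild instability (critical `z` on the unit circle), localized in space (critical `κ` in
the open unit disk). -/
def MildlyUnstableLocalized (lam C : ℝ) (s : Fin 3 → ℝ) (bc : BoundaryCondition) : Prop :=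
  ¬ StronglyStable lam C s bc ∧ ¬ StronglyStableObserved lam C s bc ∧
    (∃ z κ, IsCritical C s bc z κ) ∧ ∀ z κ, IsCritical C s bc z κ → ‖z‖ = 1 ∧ ‖κ‖ < 1

/-- MU-E: mild instability (critical `z` on the unit circle), extended in space (critical `κ` on
the unit circle). -/
def MildlyUnstableExtended (lam C : ℝ) (s : Fin 3 → ℝ) (bc : BoundaryCondition) : Prop :=
  ¬ StronglyStable lam C s bc ∧ ¬ StronglyStableObserved lam C s bc ∧
    (∃ z κ, IsCritical C s bc z κ) ∧ ∀ z κ, IsCritical C s bc z κ → ‖z‖ = 1 ∧ ‖κ‖ = 1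

/-- The bound `s₃⋆` in the condition `s₃ ≤ s₃⋆(s₂)` for the stability of the Cauchy problem; the
denominator vanishes in `(0, 2)` only at `4 - 2 √2`, where the value is given by continuity. -/
def s₃star (x : ℝ) : ℝ :=
  if x = 4 - 2 * Real.sqrt 2 then 1
  else 1 + (Real.sqrt ((x ^ 2 - 8 * x + 8) ^ 2 + 4 * x ^ 2 * (2 - x) ^ 2) - 2 * x * (2 - x)) /
    (x ^ 2 - 8 * x + 8)

end D1Q3

end

noncomputable section

namespace D1Q3

open Matrix Filter Topology
open scoped ENNReal

/-! ### The characteristic polynomial on the bitorus -/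

/-! Write w = 1/z, a = 1 - s₂, b = 1 - s₃. After a generating-function transform in time, the
solution with zero initial data is a multiple of the bulk mode κ^j, where κ = κ(w) is the stable
root. The multiple is the transformed source divided by the Lopatinskii functional `lop` of the mode
(ρ, U, V). For the five boundary conditions this functional is U - V, U + V, ρ, (1 - κ)^σ U and U,
so everything depends on where these vanish for |w| ≤ 1.

Stable root: the bound on s₃ excludes |w| = |κ| = 1 except for κ = 1 (`dispersion_real`,
`charPoly_circle`). Continuation from κ = -1 then gives the von Neumann condition
(`charPoly_ne_zero`), and continuation from w = 0 gives a root in the disk. Exchanging C and -C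
exchanges κ and 1/κ; this yields uniqueness and a closed inequality that survives in the limit |w| →
1. The resulting compact set `stableGraph` contains over w = 1 no point other than κ = 1 if C > 0,
and none other than κ = `otherRoot` if C < 0.

Stability: if the functional has no zero on the nonzero modes over `stableGraph`, compactness bounds
the modes by it (`exists_bound_of_ne_zero`). The Schwarz lemma gives |κ(w)| ≤ |w|, so the transfer
function at x_j is O(|w|^j). Fourier analysis on the circle of radius e^(-αΔt) turns this into an ℓ²
bound (`sum_conv_le`), and the geometric sum over j is balanced by the factor α/(1 + αΔt).

Instability: the mass balance (1 - w)ρ = (1 - κ)(U - V) shows that U = V forces w = 1, and then κ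
lies inside the disk if C < 0 and outside the closed disk if C > 0. Since U never vanishes, (1 -
κ)^σ U vanishes only at κ = 1, which is a limit of the stable root only if C > 0. In both unstable
cases the functional is O(|1 - w|), so at w = e^(-2α) the transfer function at x₀ is at least of
order 1/α, whereas an estimate would allow only α^(-1/2) (`not_stronglyStableObserved`). -/

/-- The real form of the dispersion relation for `|z| = |κ| = 1` has no solution with `κ ≠ 1`. -/
theorem dispersion_real {p q C k s K S : ℝ} (hp : 0 < p) (hq : 0 < q)
    (H : p + q ≤ p * q * (2 * p + q)) (hC0 : C ≠ 0) (hC1 : C ^ 2 < 1)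
    (hks : k ^ 2 + s ^ 2 = 1) (hKS : K ^ 2 + S ^ 2 = 1)
    (hR : k * (S ^ 2 * C ^ 2 * p - s ^ 2 * (p + q)) = S * K * C * s * q)
    (hI : s * (1 - s ^ 2 - S ^ 2 + p * q * (S ^ 2 - s ^ 2) + S ^ 2 * C ^ 2) = -(S * K * C * k)) :
    S = 0 := by
  by_contra hS
  have hy : 0 < S ^ 2 := by positivity
  have hCC : 0 < C ^ 2 := by positivity
  have hk : k ^ 2 = 1 - s ^ 2 := by linarith
  have hK : K ^ 2 = 1 - S ^ 2 := by linarith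
  have hx1 : s ^ 2 ≤ 1 := by nlinarith [sq_nonneg k]
  have hs : s ≠ 0 := by
    rintro rfl
    have hk0 : k ≠ 0 := by rintro rfl; norm_num at hks
    have : k * (S ^ 2 * C ^ 2 * p) = 0 := by linarith [hR]
    exact (mul_ne_zero hk0 (by positivity)) this
  have hx : 0 < s ^ 2 := by positivity
  -- In the unknowns x = s², δ and η one has S²C² = x + δ and S² = x + δ + η, which removes C, k and
  -- K from the two relations below.
  obtain ⟨η, hη⟩ : ∃ η, η = S ^ 2 - S ^ 2 * C ^ 2 := ⟨_, rfl⟩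
  obtain ⟨δ, hδ⟩ : ∃ δ, δ = S ^ 2 * C ^ 2 - s ^ 2 := ⟨_, rfl⟩
  have hη0 : 0 < η := by rw [hη]; nlinarith
  have hW : S ^ 2 * C ^ 2 = s ^ 2 + δ := by linarith
  have hyy : S ^ 2 = s ^ 2 + δ + η := by linarith
  have hW0 : 0 < s ^ 2 + δ := by rw [← hW]; positivity
  -- The combination of `hR` and `hI` is chosen so that the cross term S K C cancels; in `E2`,
  -- squaring `hR` leaves only even powers.
  have E1 : p * (1 - s ^ 2) * δ - q * s ^ 2 * η + p * q ^ 2 * s ^ 2 * (δ + η) = 0 := by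
    have h : k ^ 2 * (S ^ 2 * C ^ 2 * p - s ^ 2 * (p + q))
        + q * s ^ 2 * (1 - s ^ 2 - S ^ 2 + p * q * (S ^ 2 - s ^ 2) + S ^ 2 * C ^ 2) = 0 := by
      linear_combination k * hR + s * q * hI
    rw [hk, hW, hyy] at h
    linear_combination h
  have E2 : (1 - s ^ 2) * (p * δ - q * s ^ 2) ^ 2
      = (s ^ 2 + δ) * (1 - s ^ 2 - δ - η) * s ^ 2 * q ^ 2 := by
    have h : k ^ 2 * (S ^ 2 * C ^ 2 * p - s ^ 2 * (p + q)) ^ 2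
        = (S ^ 2 * C ^ 2) * K ^ 2 * s ^ 2 * q ^ 2 := by
      have : (k * (S ^ 2 * C ^ 2 * p - s ^ 2 * (p + q))) ^ 2 = (S * K * C * s * q) ^ 2 := by rw [hR]
      linear_combination this
    rw [hk, hK, hW, hyy] at h
    linear_combination h
  generalize s ^ 2 = x at *
  clear hR hI hW hyy hk hK hks hKS hδ hη
  obtain ⟨n, hn⟩ : ∃ n, n = p * (1 - x + q ^ 2 * x) := ⟨_, rfl⟩
  obtain ⟨m, hm⟩ : ∃ m, m = q * (1 - p * q) := ⟨_, rfl⟩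
  have hn0 : 0 < n := by
    rw [hn]
    rcases hx1.lt_or_eq with h | h
    · have : 0 < 1 - x := by linarith
      positivity
    · rw [h]; simp; positivity
  have hnm : n * δ = m * x * η := by rw [hn, hm]; linear_combination E1
  -- By `hnm`, δ is proportional to η; after multiplication by n², `E2` has the factor x²η, and the
  -- quotient is affine in η.
  have hF : η * (m ^ 2 * ((1 - x) * p ^ 2 + q ^ 2 * x) + q ^ 2 * m * n)
      + q * n * (q * n - m * (q * (1 - 2 * x) + 2 * p * (1 - x))) = 0 := by
    have h : x ^ 2 * η * (η * (m ^ 2 * ((1 - x) * p ^ 2 + q ^ 2 * x) + q ^ 2 * m * n)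
      + q * n * (q * n - m * (q * (1 - 2 * x) + 2 * p * (1 - x)))) = 0 := by
      linear_combination n ^ 2 * E2 - ((1 - x) * p ^ 2 * (n * δ + m * x * η)
        - (1 - x) * 2 * p * q * x * n - q ^ 2 * x * (1 - 2 * x) * n
        + q ^ 2 * x * (n * δ + m * x * η) + q ^ 2 * x * η * n) * hnm
    exact (mul_eq_zero.1 h).resolve_left (by positivity)
  have hc : q * n - m * (q * (1 - 2 * x) + 2 * p * (1 - x))
      = q * ((1 - x) * (p * q * (2 * p + q) - (p + q)) + x * q) := by
    rw [hn, hm]; ring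
  -- This is where `H` enters: it makes the constant term of `hF` positive.
  have hc0 : 0 < q * n - m * (q * (1 - 2 * x) + 2 * p * (1 - x)) := by
    rw [hc]
    have : 0 ≤ (1 - x) * (p * q * (2 * p + q) - (p + q)) :=
      mul_nonneg (by linarith) (by linarith)
    positivity
  have hqn : 0 < q * n := by positivity
  have hc1 := mul_pos hqn hc0
  have hx1' : 0 ≤ 1 - x := by linarith
  rcases le_or_gt 0 m with h | h
  · have : 0 ≤ η * (m ^ 2 * ((1 - x) * p ^ 2 + q ^ 2 * x) + q ^ 2 * m * n) := by positivity
    linarith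
  -- For m < 0, positivity of S²C² = x + δ gives n + mη > 0. When the bracket in `hF` is positive,
  -- its product with n + mη combined with `hF` leaves n m (1 - x)(p + q)² > 0, which is absurd.
  · have hnη : 0 < n + m * η := by
      have : 0 < x * (n + m * η) := by nlinarith [mul_pos hn0 hW0]
      exact (mul_pos_iff_of_pos_left hx).1 this
    rcases le_or_gt (m * ((1 - x) * p ^ 2 + q ^ 2 * x) + q ^ 2 * n) 0 with hb | hb
    · have : 0 ≤ (η * -m) * -(m * ((1 - x) * p ^ 2 + q ^ 2 * x) + q ^ 2 * n) :=
        mul_nonneg (mul_nonneg hη0.le (by linarith)) (by linarith)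
      nlinarith
    · have h1 := mul_pos hnη hb
      have h2 : 0 ≤ (-m * n) * ((1 - x) * (p + q) ^ 2) :=
        mul_nonneg (mul_nonneg (by linarith) hn0.le) (by positivity)
      nlinarith

/-- The characteristic polynomial of the bulk scheme in the variables `w = z⁻¹` and `κ`, with
`a = 1 - s₂` and `b = 1 - s₃`. -/
def charPoly (a b C : ℝ) (w κ : ℂ) : ℂ :=
  -(1 - w) * (2 * κ * (1 + a * b * w ^ 2) - (a + b) * w * (1 + κ ^ 2))
    + w * (1 - κ) ^ 2 * ((1 - b) * C ^ 2) * (1 + a * w)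
    + w * (1 - κ ^ 2) * ((1 - a) * C) * (1 - b * w)

/-- The admissible parameters, with `a = 1 - s₂` and `b = 1 - s₃`. -/
structure Admissible (a b C : ℝ) : Prop where
  ha : |a| < 1
  hb : |b| < 1
  hC0 : C ≠ 0
  hC1 : C ^ 2 < 1
  stable : 0 ≤ (a ^ 2 + 6 * a + 1) * (1 - b ^ 2) + 4 * (1 - a ^ 2) * b

theorem Admissible.neg {a b C : ℝ} (h : Admissible a b C) : Admissible a b (-C) :=
  ⟨h.ha, h.hb, neg_ne_zero.2 h.hC0, by simpa using h.hC1, h.stable⟩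

theorem exists_sq_eq_of_norm_eq_one {w : ℂ} (hw : ‖w‖ = 1) :
    ∃ x y : ℝ, x ^ 2 + y ^ 2 = 1 ∧ ((x : ℂ) + y * Complex.I) ^ 2 = w := by
  obtain ⟨v, hv⟩ := IsAlgClosed.exists_pow_nat_eq w (n := 2) two_pos
  refine ⟨v.re, v.im, ?_, by rw [Complex.re_add_im, hv]⟩
  have h : ‖v‖ ^ 2 = 1 := by rw [← norm_pow, hv, hw]
  rw [← h, ← Complex.normSq_eq_norm_sq, Complex.normSq_apply]; ring

theorem charPoly_circle {a b C : ℝ} (h : Admissible a b C) {w κ : ℂ} (hw : ‖w‖ = 1)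
    (hκ : ‖κ‖ = 1) (hD : charPoly a b C w κ = 0) : κ = 1 := by
  obtain ⟨k, s, hks, rfl⟩ := exists_sq_eq_of_norm_eq_one hw
  obtain ⟨K, S, hKS, rfl⟩ := exists_sq_eq_of_norm_eq_one hκ
  have ha := abs_lt.1 h.ha
  have hb := abs_lt.1 h.hb
  set ω : ℂ := (k : ℂ) + s * Complex.I with hω
  set ν : ℂ := (K : ℂ) + S * Complex.I with hν
  have hI := Complex.I_sq
  have e1 : ω * ((k : ℂ) - s * Complex.I) = 1 := by
    have : (k : ℂ) ^ 2 + (s : ℂ) ^ 2 = 1 := by exact_mod_cast hks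
    rw [hω]; linear_combination this - (s : ℂ) ^ 2 * hI
  have e2 : ν * ((K : ℂ) - S * Complex.I) = 1 := by
    have : (K : ℂ) ^ 2 + (S : ℂ) ^ 2 = 1 := by exact_mod_cast hKS
    rw [hν]; linear_combination this - (S : ℂ) ^ 2 * hI
  have hω0 : ω ≠ 0 := left_ne_zero_of_mul_eq_one e1
  have hν0 : ν ≠ 0 := left_ne_zero_of_mul_eq_one e2
  have e1' : ω⁻¹ = (k : ℂ) - s * Complex.I := by
    rw [inv_eq_iff_eq_inv]; exact eq_inv_of_mul_eq_one_left e1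
  have e2' : ν⁻¹ = (K : ℂ) - S * Complex.I := by
    rw [inv_eq_iff_eq_inv]; exact eq_inv_of_mul_eq_one_left e2
  -- Half angles: dividing by ω³ν² leaves combinations of ω, ν and their conjugates, whose real and
  -- imaginary parts give the two equations of `dispersion_real`.
  have key : charPoly a b C (ω ^ 2) (ν ^ 2) = ω ^ 3 * ν ^ 2 *
      (-(ω⁻¹ - ω) * (2 * (ω⁻¹ ^ 2 + a * b * ω ^ 2) - (a + b) * (ν⁻¹ ^ 2 + ν ^ 2))
        + (ν⁻¹ - ν) ^ 2 * ((1 - b) * C ^ 2) * (ω⁻¹ + a * ω)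
        + (ν⁻¹ ^ 2 - ν ^ 2) * ((1 - a) * C) * (ω⁻¹ - b * ω)) := by
    unfold charPoly; field_simp
  rw [key] at hD
  have hE := (mul_eq_zero.1 hD).resolve_left (by positivity)
  rw [e1', e2', hω, hν] at hE
  have hre := congrArg Complex.re hE
  have him := congrArg Complex.im hE
  simp [pow_two] at hre him
  have h1a : 0 < 1 - a := by linarith
  have h1b : 0 < 1 - b := by linarith
  have h1a' : 0 < 1 + a := by linarith
  have h1b' : 0 < 1 + b := by linarith
  have hS : S = 0 := by
    refine dispersion_real (p := (1 + a) / (1 - a)) (q := (1 + b) / (1 - b)) (C := -C) (k := k)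
      (s := s) (K := K) (S := S) (by positivity) (by positivity) ?_ (neg_ne_zero.2 h.hC0)
      (by simpa using h.hC1) hks hKS ?_ ?_
    -- `Admissible.stable` is the inequality on p and q after clearing denominators.
    · rw [← sub_nonneg]
      have : (1 + a) / (1 - a) * ((1 + b) / (1 - b)) *
          (2 * ((1 + a) / (1 - a)) + (1 + b) / (1 - b)) - ((1 + a) / (1 - a) + (1 + b) / (1 - b))
          = ((a ^ 2 + 6 * a + 1) * (1 - b ^ 2) + 4 * (1 - a ^ 2) * b)
            / ((1 - a) ^ 2 * (1 - b) ^ 2) := by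
        field_simp; ring
      rw [this]
      exact div_nonneg h.stable (by positivity)
    · field_simp
      linear_combination (-1 / 4) * hre
    · field_simp
      have : K ^ 2 = 1 - S ^ 2 := by linarith
      have hk : k ^ 2 = 1 - s ^ 2 := by linarith
      linear_combination (1 / 4) * him + ((a + b) * s) * this - s * (1 + a * b) * hk
  have hK : K ^ 2 = 1 := by rw [← hKS, hS]; ring
  rw [hν, hS]
  have : (K : ℂ) ^ 2 = 1 := by exact_mod_cast hK
  simp [this]

/-! ### The stable root -/

section ZeroCounting

variable {X : Type*} [TopologicalSpace X] {F : X → ℂ → ℂ}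

/-- A zero in the open unit disk persists under perturbation, if there are none on the circle. -/
theorem eventually_exists_zero (hF : Continuous (Function.uncurry F))
    (hd : ∀ x, Differentiable ℂ (F x)) (hs : ∀ x κ, ‖κ‖ = 1 → F x κ ≠ 0) {x₀ : X}
    (h₀ : ∃ κ, ‖κ‖ < 1 ∧ F x₀ κ = 0) : ∀ᶠ x in 𝓝 x₀, ∃ κ, ‖κ‖ < 1 ∧ F x κ = 0 := by
  obtain ⟨κ₀, hκ₀, hF₀⟩ := h₀
  have hev : ∀ᶠ x in 𝓝 x₀, ∀ κ ∈ Metric.sphere (0 : ℂ) 1, ‖F x κ₀‖ < ‖F x κ‖ := by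
    refine (isCompact_sphere (0 : ℂ) 1).eventually_forall_of_forall_eventually fun κ hκ => ?_
    have hc1 : Continuous fun p : X × ℂ => ‖F p.1 κ₀‖ :=
      (hF.comp (continuous_fst.prodMk continuous_const)).norm
    have hc2 : Continuous fun p : X × ℂ => ‖F p.1 p.2‖ := hF.norm
    refine (hc1.tendsto (x₀, κ)).eventually_lt (hc2.tendsto (x₀, κ)) ?_
    simpa [hF₀] using hs x₀ κ (by simpa using hκ)
  filter_upwards [hev] with x hx
  -- Without zeros in the closed disk, the maximum principle for 1/F bounds |1/F| at κ₀ by its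
  -- maximum on the circle, against `hx`.
  by_contra! hne
  have hne' : ∀ κ ∈ Metric.closedBall (0 : ℂ) 1, F x κ ≠ 0 := fun κ hκ => by
    rcases (mem_closedBall_zero_iff.1 hκ).lt_or_eq with h | h
    exacts [hne κ h, hs x κ h]
  have hdiff : DiffContOnCl ℂ (fun κ => (F x κ)⁻¹) (Metric.ball 0 1) := by
    refine (hd x).diffContOnCl.inv fun κ hκ => hne' κ ?_
    rwa [closure_ball _ one_ne_zero] at hκ
  obtain ⟨κ, hκ, hmax⟩ := Complex.exists_mem_frontier_isMaxOn_norm Metric.isBounded_ball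
    (Metric.nonempty_ball.2 one_pos) hdiff
  rw [frontier_ball _ one_ne_zero] at hκ
  have h1 := hmax (subset_closure (mem_ball_zero_iff.2 hκ₀))
  simp only [Set.mem_ofPred_eq, Function.comp, norm_inv] at h1
  have h2 := hx κ hκ
  have h3 : 0 < ‖F x κ₀‖ := norm_pos_iff.2 (hne κ₀ hκ₀)
  exact absurd ((inv_le_inv₀ h3 (h3.trans h2)).1 h1) (not_le.2 h2)

/-- The parameters with a zero in the disk form a clopen set: open by persistence, closed because
absence of zeros on the compact closed disk is an open condition. -/
theorem forall_exists_zero [PreconnectedSpace X] (hF : Continuous (Function.uncurry F))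
    (hd : ∀ x, Differentiable ℂ (F x)) (hs : ∀ x κ, ‖κ‖ = 1 → F x κ ≠ 0) {x₀ : X}
    (h₀ : ∃ κ, ‖κ‖ < 1 ∧ F x₀ κ = 0) (x : X) : ∃ κ, ‖κ‖ < 1 ∧ F x κ = 0 := by
  have hopen : IsOpen {x | ∃ κ, ‖κ‖ < 1 ∧ F x κ = 0} :=
    isOpen_iff_eventually.2 fun x hx => eventually_exists_zero hF hd hs hx
  have hclosed : IsClosed {x | ∃ κ, ‖κ‖ < 1 ∧ F x κ = 0} := by
    rw [← isOpen_compl_iff, isOpen_iff_eventually]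
    intro x hx
    have : ∀ᶠ y in 𝓝 x, ∀ κ ∈ Metric.closedBall (0 : ℂ) 1, F y κ ≠ 0 := by
      refine (isCompact_closedBall (0 : ℂ) 1).eventually_forall_of_forall_eventually fun κ hκ => ?_
      refine (hF.tendsto (x, κ)).eventually_ne ?_
      rcases (mem_closedBall_zero_iff.1 hκ).lt_or_eq with h | h
      exacts [fun h0 => hx ⟨κ, h, h0⟩, hs x κ h]
    filter_upwards [this] with y hy
    rintro ⟨κ, hκ, h0⟩
    exact hy κ (mem_closedBall_zero_iff.2 hκ.le) h0
  exact (IsClopen.eq_univ ⟨hclosed, hopen⟩ ⟨x₀, h₀⟩).symm.subset (Set.mem_univ x)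

end ZeroCounting

/-! ### The von Neumann condition. -/

theorem continuous_charPoly (a b C : ℝ) :
    Continuous fun p : ℂ × ℂ => charPoly a b C p.1 p.2 := by
  unfold charPoly; fun_prop

theorem one_add_ne_zero_of_norm_lt {x : ℂ} (hx : ‖x‖ < 1) : 1 + x ≠ 0 := fun h => by
  have : x = -1 := by linear_combination h
  simp [this] at hx

theorem one_sub_ne_zero_of_norm_lt {x : ℂ} (hx : ‖x‖ < 1) : 1 - x ≠ 0 := fun h => by
  have : x = 1 := by linear_combination -h
  simp [this] at hx

theorem norm_real_mul_lt {a : ℝ} (ha : |a| < 1) {w : ℂ} (hw : ‖w‖ ≤ 1) : ‖(a : ℂ) * w‖ < 1 := by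
  rw [norm_mul, Complex.norm_real, Real.norm_eq_abs]
  nlinarith [abs_nonneg a, norm_nonneg w]

/-- This factor occurs both in the characteristic polynomial at κ = -1 and in the condition U + V =
0. The imaginary part of the equation times the conjugate of w forces w = x real. The equation then
reads (1 - x)(1 + bx) = -2(1 - b)C²x, impossible for x ≥ 0, and equally (1 + x)(1 - bx) = 2(1 - b)(1
- C²)x, impossible for x ≤ 0. -/
theorem quadratic_ne_zero {b C : ℝ} (hb : |b| < 1) (hC0 : C ≠ 0) (hC1 : C ^ 2 < 1) {w : ℂ}
    (hw : ‖w‖ ≤ 1) : (1 - w) * (1 + b * w) + 2 * ((1 - b) * C ^ 2) * w ≠ 0 := by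
  intro h
  obtain ⟨hb1, hb2⟩ := abs_lt.1 hb
  have hsq : w.re ^ 2 + w.im ^ 2 ≤ 1 := by
    have : ‖w‖ ^ 2 ≤ 1 := by nlinarith [norm_nonneg w]
    rwa [← Complex.normSq_eq_norm_sq, Complex.normSq_apply, ← pow_two, ← pow_two] at this
  have hre := congrArg Complex.re h
  have him := congrArg Complex.im h
  simp [pow_two] at hre him
  have hCC : 0 < C ^ 2 := by positivity
  set x := w.re
  set y := w.im
  have hy : y = 0 := by
    have h1 : y * (1 + b * (x ^ 2 + y ^ 2)) = 0 := by linear_combination y * hre - x * him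
    refine (mul_eq_zero.1 h1).resolve_right (ne_of_gt ?_)
    nlinarith [sq_nonneg x, sq_nonneg y]
  rw [hy] at hre hsq
  have h2 : 1 - b * x ^ 2 = (1 - b) * (1 - 2 * C ^ 2) * x := by linear_combination hre
  have hx : x ^ 2 ≤ 1 := by linarith
  obtain ⟨hx1, hx2⟩ := abs_le.1 (sq_le_one_iff_abs_le_one _ |>.1 hx)
  rcases le_total 0 x with h0 | h0
  · have h3 : 0 ≤ (1 - x) * (1 + b * x) := mul_nonneg (by linarith) (by nlinarith)
    have h4 : (1 - b) * C ^ 2 * x ≤ 0 := by nlinarith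
    have h5 : x = 0 := by
      by_contra hne
      have : 0 < x := lt_of_le_of_ne h0 (Ne.symm hne)
      have : 0 < (1 - b) * C ^ 2 * x := by
        have : 0 < 1 - b := by linarith
        positivity
      linarith
    rw [h5] at h2; norm_num at h2
  · have h3 : 0 ≤ (1 + x) * (1 - b * x) := mul_nonneg (by linarith) (by nlinarith)
    have h4 : (1 - b) * (1 - C ^ 2) * (-x) ≤ 0 := by nlinarith
    have h5 : x = 0 := by
      by_contra hne
      have : 0 < -x := by
        rcases h0.lt_or_eq with h | h
        exacts [by linarith, absurd h hne]
      have : 0 < (1 - b) * (1 - C ^ 2) * (-x) :=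
        mul_pos (mul_pos (by linarith) (by linarith)) this
      linarith
    rw [h5] at h2; norm_num at h2

theorem charPoly_one (a b C : ℝ) (w : ℂ) :
    charPoly a b C w 1 = -(2 * (1 - w) * (1 - a * w) * (1 - b * w)) := by
  unfold charPoly; ring

theorem charPoly_neg_one (a b C : ℝ) (w : ℂ) :
    charPoly a b C w (-1)
      = 2 * (1 + a * w) * ((1 - w) * (1 + b * w) + 2 * ((1 - b) * C ^ 2) * w) := by
  unfold charPoly; ring

theorem charPoly_one_ne_zero {a b C : ℝ} (h : Admissible a b C) {w : ℂ} (hw : ‖w‖ ≤ 1)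
    (hw1 : w ≠ 1) : charPoly a b C w 1 ≠ 0 := by
  rw [charPoly_one, neg_ne_zero]
  exact mul_ne_zero (mul_ne_zero (mul_ne_zero two_ne_zero (sub_ne_zero.2 hw1.symm))
    (one_sub_ne_zero_of_norm_lt (norm_real_mul_lt h.ha hw)))
    (one_sub_ne_zero_of_norm_lt (norm_real_mul_lt h.hb hw))

theorem charPoly_neg_one_ne_zero {a b C : ℝ} (h : Admissible a b C) {w : ℂ} (hw : ‖w‖ ≤ 1) :
    charPoly a b C w (-1) ≠ 0 := by
  rw [charPoly_neg_one]
  exact mul_ne_zero (mul_ne_zero two_ne_zero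
    (one_add_ne_zero_of_norm_lt (norm_real_mul_lt h.ha hw)))
    (quadratic_ne_zero h.hb h.hC0 h.hC1 hw)

/-- The von Neumann condition: no `|z| > 1` for `|κ| = 1`. -/
theorem charPoly_ne_zero {a b C : ℝ} (h : Admissible a b C) {w κ : ℂ} (hw : ‖w‖ < 1)
    (hκ : ‖κ‖ = 1) : charPoly a b C w κ ≠ 0 := by
  intro hD
  by_cases hκ1 : κ = 1
  · refine charPoly_one_ne_zero h hw.le ?_ (hκ1 ▸ hD)
    rintro rfl; simp at hw
  -- The arc κ = -e^(it), |t| < π, is the circle without κ = 1, so no zero w crosses |w| = 1 along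
  -- it. A zero in the disk would be carried to t = 0, that is κ = -1, where the polynomial factors.
  have : PreconnectedSpace (Set.Ioo (-Real.pi) Real.pi) :=
    isPreconnected_iff_preconnectedSpace.1 isPreconnected_Ioo
  let F : Set.Ioo (-Real.pi) Real.pi → ℂ → ℂ :=
    fun t w => charPoly a b C w (-Complex.exp (t * Complex.I))
  have hF : Continuous (Function.uncurry F) := by
    have : Continuous fun p : Set.Ioo (-Real.pi) Real.pi × ℂ =>
        (p.2, -Complex.exp ((p.1 : ℝ) * Complex.I)) := by fun_prop
    exact (continuous_charPoly a b C).comp this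
  have hd : ∀ t, Differentiable ℂ (F t) := fun t => by
    simp only [F, charPoly]; fun_prop
  have hs : ∀ t κ, ‖κ‖ = 1 → F t κ ≠ 0 := by
    intro t w hw h0
    have h1 := charPoly_circle h hw (by simp) h0
    have h2 : Complex.exp (((t : ℝ) : ℂ) * Complex.I) = -1 := by linear_combination -h1
    have h3 := congrArg Complex.arg h2
    rw [Complex.arg_exp_mul_I, Complex.arg_neg_one,
      (toIocMod_eq_self Real.two_pi_pos).2 ⟨t.2.1, by linarith [t.2.2]⟩] at h3
    exact t.2.2.ne h3
  have harg : (-κ).arg ∈ Set.Ioo (-Real.pi) Real.pi := by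
    refine ⟨Complex.neg_pi_lt_arg _, lt_of_le_of_ne (Complex.arg_le_pi _) fun h0 => hκ1 ?_⟩
    have := Complex.norm_mul_exp_arg_mul_I (-κ)
    rw [h0, norm_neg, hκ] at this
    simp at this
    linear_combination -this
  have hx : ∃ w, ‖w‖ < 1 ∧ F ⟨_, harg⟩ w = 0 := by
    refine ⟨w, hw, ?_⟩
    have := Complex.norm_mul_exp_arg_mul_I (-κ)
    rw [norm_neg, hκ, Complex.ofReal_one, one_mul] at this
    simp only [F, this, neg_neg, hD]
  obtain ⟨w', hw', h0⟩ := forall_exists_zero hF hd hs hx ⟨0, by simp [Real.pi_pos], Real.pi_pos⟩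
  simp only [F, Complex.ofReal_zero, zero_mul, Complex.exp_zero] at h0
  exact charPoly_neg_one_ne_zero h hw'.le h0

/-- The leading coefficient of the characteristic polynomial, in `κ`. -/
def leadCoeff (a b C : ℝ) (w : ℂ) : ℂ :=
  (1 - w) * (a + b) * w + w * ((1 - b) * C ^ 2) * (1 + a * w) - w * ((1 - a) * C) * (1 - b * w)

/-- The middle coefficient of the characteristic polynomial, in `κ`. -/
def midCoeff (a b C : ℝ) (w : ℂ) : ℂ :=
  -2 * (1 - w) * (1 + a * b * w ^ 2) - 2 * w * ((1 - b) * C ^ 2) * (1 + a * w)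

theorem charPoly_eq (a b C : ℝ) (w κ : ℂ) : charPoly a b C w κ
    = leadCoeff a b C w * κ ^ 2 + midCoeff a b C w * κ + leadCoeff a b (-C) w := by
  simp only [charPoly, leadCoeff, midCoeff]; push_cast; ring

theorem midCoeff_neg (a b C : ℝ) (w : ℂ) : midCoeff a b (-C) w = midCoeff a b C w := by
  simp only [midCoeff]; push_cast; ring

theorem exists_stable_root {a b C : ℝ} (h : Admissible a b C) {w : ℂ} (hw : ‖w‖ < 1) :
    ∃ κ, ‖κ‖ < 1 ∧ charPoly a b C w κ = 0 := by
  have : PreconnectedSpace (Metric.ball (0 : ℂ) 1) :=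
    isPreconnected_iff_preconnectedSpace.1 (convex_ball _ _).isPreconnected
  refine forall_exists_zero (X := Metric.ball (0 : ℂ) 1) (F := fun w κ => charPoly a b C w κ)
    (x₀ := ⟨0, by simp⟩) ?_ ?_ ?_ ?_ ⟨w, by simpa using hw⟩
  · exact (continuous_charPoly a b C).comp
      ((continuous_subtype_val.comp continuous_fst).prodMk continuous_snd)
  · intro w; simp only [charPoly]; fun_prop
  · exact fun w κ hκ => charPoly_ne_zero h (mem_ball_zero_iff.1 w.2) hκ
  -- At w = 0 the polynomial is -2κ.
  · exact ⟨0, by simp, by simp [charPoly]⟩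

/-- The stable root, as a function of `w = z⁻¹`. -/
def stableRoot (a b C : ℝ) (w : ℂ) : ℂ :=
  Classical.epsilon fun κ => ‖κ‖ < 1 ∧ charPoly a b C w κ = 0

section

variable {a b C : ℝ} {w κ : ℂ}

theorem norm_stableRoot_lt (h : Admissible a b C) (hw : ‖w‖ < 1) : ‖stableRoot a b C w‖ < 1 :=
  (Classical.epsilon_spec (exists_stable_root h hw)).1

theorem charPoly_stableRoot (h : Admissible a b C) (hw : ‖w‖ < 1) :
    charPoly a b C w (stableRoot a b C w) = 0 :=
  (Classical.epsilon_spec (exists_stable_root h hw)).2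

/-- Vieta's relation between the stable roots for the velocities `C` and `-C`. -/
theorem leadCoeff_mul_eq {κ' : ℂ} (hκ : ‖κ‖ < 1) (hκ' : ‖κ'‖ < 1) (hD : charPoly a b C w κ = 0)
    (hD' : charPoly a b (-C) w κ' = 0) :
    leadCoeff a b C w * κ = leadCoeff a b (-C) w * κ' := by
  rw [charPoly_eq] at hD hD'
  rw [neg_neg, midCoeff_neg] at hD'
  have hne : κ * κ' - 1 ≠ 0 := by
    rw [sub_ne_zero]
    intro h1
    have : ‖κ * κ'‖ < 1 := by
      rw [norm_mul]; nlinarith [norm_nonneg κ, norm_nonneg κ']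
    simp [h1] at this
  -- Exchanging C and -C reverses the polynomial in κ, so κ' plays the role of the reciprocal of the
  -- unstable root; eliminating the middle coefficient leaves this product.
  have : (κ * κ' - 1) * (leadCoeff a b C w * κ - leadCoeff a b (-C) w * κ') = 0 := by
    linear_combination κ' * hD - κ * hD'
  exact sub_eq_zero.1 ((mul_eq_zero.1 this).resolve_left hne)

theorem coeff_ne_zero (h : Admissible a b C) (hw : ‖w‖ < 1) (h1 : leadCoeff a b C w = 0)
    (h2 : midCoeff a b C w = 0) (h3 : leadCoeff a b (-C) w = 0) : False := by
  refine charPoly_ne_zero h hw (κ := 1) (by simp) ?_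
  rw [charPoly_eq, h1, h2, h3]; ring

/-- Two distinct roots in the disk would satisfy Vieta's relation with the same κ', so the leading
coefficient would vanish, then the middle and the last one, against the von Neumann condition. -/
theorem eq_stableRoot (h : Admissible a b C) (hw : ‖w‖ < 1) (hκ : ‖κ‖ < 1)
    (hD : charPoly a b C w κ = 0) : κ = stableRoot a b C w := by
  have hκ₂ := norm_stableRoot_lt h hw
  have hD₂ := charPoly_stableRoot h hw
  obtain ⟨κ', hκ', hD'⟩ := exists_stable_root h.neg hw
  have e1 := leadCoeff_mul_eq hκ hκ' hD hD'
  have e2 := leadCoeff_mul_eq hκ₂ hκ' hD₂ hD'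
  set κ₂ := stableRoot a b C w
  by_contra hne
  have hne' : κ - κ₂ ≠ 0 := sub_ne_zero.2 hne
  have hA : leadCoeff a b C w = 0 :=
    (mul_eq_zero.1 (show leadCoeff a b C w * (κ - κ₂) = 0 by linear_combination e1 - e2)).resolve_right hne'
  rw [charPoly_eq] at hD hD₂
  have hB : midCoeff a b C w = 0 := by
    refine (mul_eq_zero.1 (show midCoeff a b C w * (κ - κ₂) = 0 from ?_)).resolve_right hne'
    rw [hA] at hD hD₂
    linear_combination hD - hD₂
  refine coeff_ne_zero h hw hA hB ?_
  rw [hA, hB] at hD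
  linear_combination hD

/-- A closed trace of the stability of the root: it survives in the limit |w| → 1 and, for C < 0,
excludes κ = 1 at w = 1. -/
theorem norm_leadCoeff_mul_le (h : Admissible a b C) (hw : ‖w‖ < 1) :
    ‖leadCoeff a b C w‖ * ‖stableRoot a b C w‖ ≤ ‖leadCoeff a b (-C) w‖ := by
  obtain ⟨κ', hκ', hD'⟩ := exists_stable_root h.neg hw
  rw [← norm_mul, leadCoeff_mul_eq (norm_stableRoot_lt h hw) hκ' (charPoly_stableRoot h hw) hD',
    norm_mul]
  exact mul_le_of_le_one_right (norm_nonneg _) hκ'.le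

/-- The stable root is simple. -/
theorem deriv_charPoly_ne_zero (h : Admissible a b C) (hw : ‖w‖ < 1) :
    2 * leadCoeff a b C w * stableRoot a b C w + midCoeff a b C w ≠ 0 := by
  intro h0
  have hκ := norm_stableRoot_lt h hw
  have hD := charPoly_stableRoot h hw
  obtain ⟨κ', hκ', hD'⟩ := exists_stable_root h.neg hw
  have e1 := leadCoeff_mul_eq hκ hκ' hD hD'
  set κ := stableRoot a b C w
  rw [charPoly_eq] at hD hD'
  rw [neg_neg, midCoeff_neg] at hD'
  have hne : 1 - κ * κ' ≠ 0 := by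
    refine one_sub_ne_zero_of_norm_lt ?_
    rw [norm_mul]; nlinarith [norm_nonneg κ, norm_nonneg κ']
  have hE : leadCoeff a b (-C) w = leadCoeff a b C w * κ ^ 2 := by
    linear_combination hD - κ * h0
  have hAκ : leadCoeff a b C w * κ = 0 := by
    refine (mul_eq_zero.1 (show leadCoeff a b C w * κ * (1 - κ * κ') = 0 from ?_)).resolve_right hne
    rw [hE] at e1
    linear_combination e1
  have hB : midCoeff a b C w = 0 := by linear_combination h0 - 2 * hAκ
  have hE0 : leadCoeff a b (-C) w = 0 := by linear_combination hE + κ * hAκ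
  refine coeff_ne_zero h hw ?_ hB hE0
  rw [hB, hE0] at hD'
  linear_combination hD'

/-- A compact set that contains the graph of the stable root, hence its limit points. -/
def stableGraph (a b C : ℝ) : Set (ℂ × ℂ) :=
  {p | ‖p.1‖ ≤ 1 ∧ ‖p.2‖ ≤ 1 ∧ charPoly a b C p.1 p.2 = 0 ∧
    ‖leadCoeff a b C p.1‖ * ‖p.2‖ ≤ ‖leadCoeff a b (-C) p.1‖}

theorem isCompact_stableGraph (a b C : ℝ) : IsCompact (stableGraph a b C) := by
  refine ((isCompact_closedBall (0 : ℂ) 1).prod (isCompact_closedBall (0 : ℂ) 1)).of_isClosed_subset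
    ?_ fun p hp => ⟨by simpa using hp.1, by simpa using hp.2.1⟩
  have hA : ∀ C : ℝ, Continuous fun p : ℂ × ℂ => ‖leadCoeff a b C p.1‖ := fun C => by
    unfold leadCoeff; fun_prop
  refine (isClosed_le continuous_fst.norm continuous_const).inter
    ((isClosed_le continuous_snd.norm continuous_const).inter
    ((isClosed_eq (continuous_charPoly a b C) continuous_const).inter
    (isClosed_le ((hA C).mul continuous_snd.norm) (hA (-C)))))

theorem mem_stableGraph (h : Admissible a b C) (hw : ‖w‖ < 1) :
    (w, stableRoot a b C w) ∈ stableGraph a b C :=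
  ⟨hw.le, (norm_stableRoot_lt h hw).le, charPoly_stableRoot h hw, norm_leadCoeff_mul_le h hw⟩

theorem eq_stableRoot_of_mem (h : Admissible a b C) (hw : ‖w‖ < 1)
    (hκ : (w, κ) ∈ stableGraph a b C) : κ = stableRoot a b C w := by
  obtain ⟨-, h1, h2, -⟩ := hκ
  refine eq_stableRoot h hw (lt_of_le_of_ne h1 fun h3 => charPoly_ne_zero h hw h3 h2) h2

/-- Limit points of the stable root remain in the closed graph, so by compactness uniqueness over w₀
gives convergence. -/
theorem tendsto_stableRoot (h : Admissible a b C) {w₀ κ₀ : ℂ}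
    (hu : ∀ κ, (w₀, κ) ∈ stableGraph a b C → κ = κ₀) :
    Tendsto (stableRoot a b C) (𝓝[Metric.ball 0 1] w₀) (𝓝 κ₀) := by
  have hball : ∀ᶠ w in 𝓝[Metric.ball 0 1] w₀, ‖w‖ < 1 := by
    filter_upwards [self_mem_nhdsWithin] with w hw using by simpa using hw
  refine (isCompact_closedBall (0 : ℂ) 1).tendsto_nhds_of_unique_mapClusterPt ?_ ?_
  · filter_upwards [hball] with w hw using by simpa using (norm_stableRoot_lt h hw).le
  · intro κ _ hκ
    obtain ⟨𝒰, h𝒰, ht⟩ := mapClusterPt_iff_ultrafilter.1 hκ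
    refine hu κ ((isCompact_stableGraph a b C).isClosed.mem_of_tendsto
      ((tendsto_id'.2 (h𝒰.trans nhdsWithin_le_nhds)).prodMk_nhds ht) ?_)
    filter_upwards [h𝒰 hball] with w hw using mem_stableGraph h hw

theorem continuousAt_stableRoot (h : Admissible a b C) (hw : ‖w‖ < 1) :
    ContinuousAt (stableRoot a b C) w := by
  have := tendsto_stableRoot h fun κ hκ => eq_stableRoot_of_mem h hw hκ
  rwa [Metric.isOpen_ball.nhdsWithin_eq (by simpa using hw)] at this

/-- Implicit differentiation: the difference of the polynomial at (v, κ(v)) and (v, κ) factors as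
(κ(v) - κ) u(v), and u(w) ≠ 0 because the root is simple. -/
theorem differentiableOn_stableRoot (h : Admissible a b C) :
    DifferentiableOn ℂ (stableRoot a b C) (Metric.ball 0 1) := by
  intro w hw
  have hw1 : ‖w‖ < 1 := by simpa using hw
  have hcont := continuousAt_stableRoot h hw1
  set κ := stableRoot a b C w with hκ
  have hg : DifferentiableAt ℂ (fun v => charPoly a b C v κ) w := by
    unfold charPoly; fun_prop
  have hcA : Continuous (leadCoeff a b C) := by unfold leadCoeff; fun_prop
  have hcB : Continuous (midCoeff a b C) := by unfold midCoeff; fun_prop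
  set u : ℂ → ℂ := fun v => leadCoeff a b C v * (stableRoot a b C v + κ) + midCoeff a b C v with hu
  have hu_cont : Tendsto u (𝓝 w) (𝓝 (u w)) :=
    ((hcA.continuousAt.mul (hcont.add continuousAt_const)).add hcB.continuousAt)
  have hu0 : u w ≠ 0 := by
    have := deriv_charPoly_ne_zero h hw1
    simp only [hu, ← hκ]
    convert this using 1
    ring
  refine DifferentiableAt.differentiableWithinAt (HasDerivAt.differentiableAt
    (f' := -deriv (fun v => charPoly a b C v κ) w * (u w)⁻¹) ?_)
  rw [hasDerivAt_iff_tendsto_slope]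
  refine ((hasDerivAt_iff_tendsto_slope.1 hg.hasDerivAt).neg.mul
    ((hu_cont.inv₀ hu0).mono_left nhdsWithin_le_nhds)).congr' ?_
  have h1 : ∀ᶠ v in 𝓝[≠] w, u v ≠ 0 := nhdsWithin_le_nhds (hu_cont.eventually_ne hu0)
  have h2 : ∀ᶠ v in 𝓝[≠] w, ‖v‖ < 1 := nhdsWithin_le_nhds
    (continuous_norm.continuousAt.eventually_lt continuousAt_const hw1)
  filter_upwards [h1, h2, self_mem_nhdsWithin] with v hv1 hv2 hv3
  have hv : v - w ≠ 0 := sub_ne_zero.2 hv3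
  have e1 := charPoly_stableRoot h hv2
  have e2 := charPoly_stableRoot h hw1
  rw [← hκ] at e2
  have e3 : (stableRoot a b C v - κ) * u v = -charPoly a b C v κ := by
    rw [charPoly_eq] at e1 ⊢
    simp only [hu]; linear_combination e1
  rw [slope_def_field, slope_def_field, e2, sub_zero, ← hκ, eq_div_iff hv]
  field_simp
  rw [← e3, mul_comm]

/-- Schwarz lemma, as κ(0) = 0. This decay in j is what makes the sum over the grid points converge
at the right rate. -/
theorem norm_stableRoot_le (h : Admissible a b C) (hw : ‖w‖ < 1) : ‖stableRoot a b C w‖ ≤ ‖w‖ := by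
  refine Complex.norm_le_norm_of_mapsTo_ball (differentiableOn_stableRoot h) ?_ ?_ hw
  · intro v hv
    simpa using (norm_stableRoot_lt h (by simpa using hv)).le
  · exact (eq_stableRoot h (by simp) (by simp) (by simp [charPoly])).symm

end

/-! ### The eigenvectors of the bulk scheme -/

/-- The equations for the bulk mode `κ ^ j z ^ n`, with `w = z⁻¹`: `ρ` is `z` times the conserved
moment at `x₀`, `U` is the distribution function with velocity `1` at the ghost point, `V` the one
with velocity `-1` at `x₀`. -/
structure IsNull (a b C : ℝ) (w κ ρ U V : ℂ) : Prop where
  mass : (1 - w) * ρ = (1 - κ) * (U - V)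
  flux : U * (κ - a * w) - V * (1 - a * w * κ) = (1 - a) * C * w * ρ
  energy : U * (κ - b * w) + V * (1 - b * w * κ) = (1 - b) * C ^ 2 * w * ρ

section

variable {a b C : ℝ} {w κ ρ U V : ℂ}

theorem IsNull.smul (hn : IsNull a b C w κ ρ U V) (t : ℂ) :
    IsNull a b C w κ (t * ρ) (t * U) (t * V) :=
  ⟨by linear_combination t * hn.mass, by linear_combination t * hn.flux,
    by linear_combination t * hn.energy⟩

theorem Admissible.one_sub_ne (h : Admissible a b C) (hw : ‖w‖ ≤ 1) : 1 - a * w ≠ 0 :=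
  one_sub_ne_zero_of_norm_lt (norm_real_mul_lt h.ha hw)

theorem Admissible.one_sub_ne' (h : Admissible a b C) (hw : ‖w‖ ≤ 1) : 1 - b * w ≠ 0 :=
  one_sub_ne_zero_of_norm_lt (norm_real_mul_lt h.hb hw)

theorem Admissible.one_add_ne (h : Admissible a b C) (hw : ‖w‖ ≤ 1) : 1 + a * w ≠ 0 :=
  one_add_ne_zero_of_norm_lt (norm_real_mul_lt h.ha hw)

theorem norm_mul_le_one (hw : ‖w‖ ≤ 1) (hκ : ‖κ‖ ≤ 1) : ‖w * κ‖ ≤ 1 := by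
  rw [norm_mul]; exact mul_le_one₀ hw (norm_nonneg _) hκ

theorem IsNull.rho_ne_zero (hn : IsNull a b C w κ ρ U V) (h : Admissible a b C) (hw : ‖w‖ ≤ 1)
    (h0 : (ρ, U, V) ≠ 0) : ρ ≠ 0 := by
  rintro rfl
  obtain ⟨h1, h2, h3⟩ := hn
  have ha := h.one_sub_ne hw
  have hb := h.one_sub_ne' hw
  have ha' := h.one_add_ne hw
  rw [mul_zero] at h1 h2 h3
  suffices U = 0 ∧ V = 0 from h0 (by simp [this])
  by_cases hκ : κ = 1
  · subst hκ
    have e1 : U - V = 0 :=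
      (mul_eq_zero.1 (show (1 - a * w) * (U - V) = 0 by linear_combination h2)).resolve_left ha
    have e2 : U + V = 0 :=
      (mul_eq_zero.1 (show (1 - b * w) * (U + V) = 0 by linear_combination h3)).resolve_left hb
    exact ⟨by linear_combination (e1 + e2) / 2, by linear_combination (e2 - e1) / 2⟩
  · have hκ' : κ - 1 ≠ 0 := sub_ne_zero.2 hκ
    have e1 : U - V = 0 :=
      (mul_eq_zero.1 (show (κ - 1) * (U - V) = 0 by linear_combination h1)).resolve_left hκ'
    have e2 : U = 0 := by
      refine (mul_eq_zero.1 (show (κ - 1) * (1 + a * w) * U = 0 from ?_)).resolve_left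
        (mul_ne_zero hκ' ha')
      linear_combination h2 - (1 - a * w * κ) * e1
    exact ⟨e2, by linear_combination e2 - e1⟩

/-- With U = 0, flux and energy involve κ only through τ = wκ, and their compatibility makes τ a
real number t; mass and flux then determine w by a real linear equation. For C > 0 this gives |t| >
1; for C < 0 and |t| ≤ 1 it contradicts |w| ≤ 1. -/
theorem IsNull.U_ne_zero (hn : IsNull a b C w κ ρ U V) (h : Admissible a b C) (hw : ‖w‖ ≤ 1)
    (hκ : ‖κ‖ ≤ 1) (h0 : (ρ, U, V) ≠ 0) : U ≠ 0 := by
  have hρ := hn.rho_ne_zero h hw h0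
  rintro rfl
  obtain ⟨h1, h2, h3⟩ := hn
  obtain ⟨ha1, ha2⟩ := abs_lt.1 h.ha
  obtain ⟨hb1, hb2⟩ := abs_lt.1 h.hb
  have hC0 := h.hC0
  have hC1 := abs_lt.1 ((sq_lt_one_iff_abs_lt_one C).1 h.hC1)
  have hCc : (C : ℂ) ≠ 0 := by exact_mod_cast hC0
  have hw0 : w ≠ 0 := by
    rintro rfl
    have hV : V = 0 := by linear_combination -h2
    exact hρ (by linear_combination h1 - (1 - κ) * hV)
  obtain ⟨τ, hτ⟩ : ∃ τ, τ = w * κ := ⟨_, rfl⟩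
  have hτ1 : ‖τ‖ ≤ 1 := hτ ▸ norm_mul_le_one hw hκ
  have e1 : ((1 - a : ℝ) + (1 - b : ℝ) * (C : ℂ)) = τ * (b * (1 - a : ℝ) + a * (1 - b : ℝ) * C) := by
    have : (C * w * ρ) * (((1 - a : ℝ) + (1 - b : ℝ) * (C : ℂ))
        - τ * (b * (1 - a : ℝ) + a * (1 - b : ℝ) * C)) = 0 := by
      push_cast
      rw [hτ]
      linear_combination -(1 - a * w * κ) * h3 - (1 - b * w * κ) * h2
    exact sub_eq_zero.1 ((mul_eq_zero.1 this).resolve_left (mul_ne_zero (mul_ne_zero hCc hw0) hρ))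
  have e2 : 1 - a * τ + (1 - a) * C * τ = w * (1 - a * τ + (1 - a) * C) := by
    have : ρ * (1 - a * τ + (1 - a) * C * τ - w * (1 - a * τ + (1 - a) * C)) = 0 := by
      rw [hτ]
      linear_combination (1 - a * w * κ) * h1 + (1 - κ) * h2
    exact sub_eq_zero.1 ((mul_eq_zero.1 this).resolve_left hρ)
  have e1' : (((1 - a) + (1 - b) * C : ℝ) : ℂ) = τ * ((b * (1 - a) + a * (1 - b) * C : ℝ) : ℂ) := by
    push_cast at e1 ⊢; exact e1
  set X : ℝ := (1 - a) + (1 - b) * C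
  set Y : ℝ := b * (1 - a) + a * (1 - b) * C
  have hXY : X - Y = (1 - a) * (1 - b) * (1 + C) := by simp only [X, Y]; ring
  have hXYpos : 0 < X - Y := by
    rw [hXY]; exact mul_pos (mul_pos (by linarith) (by linarith)) (by linarith)
  have hY0 : Y ≠ 0 := by
    intro h0
    rw [h0, Complex.ofReal_zero, mul_zero] at e1'
    have : X = 0 := by exact_mod_cast e1'
    linarith
  have hYc : (Y : ℂ) ≠ 0 := by exact_mod_cast hY0
  obtain ⟨t, ht⟩ : ∃ t : ℝ, t = X / Y := ⟨_, rfl⟩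
  have htτ : τ = (t : ℂ) := by
    rw [ht]; push_cast; rw [eq_div_iff hYc]; exact e1'.symm
  have htX : t * Y = X := by rw [ht]; field_simp
  have ht1 : |t| ≤ 1 := by simpa [htτ] using hτ1
  obtain ⟨ht2, ht3⟩ := abs_le.1 ht1
  rcases lt_or_gt_of_ne hC0 with hC | hC
  · have ht4 : t ≠ 1 := by rintro rfl; linarith
    have ht5 : t < 1 := lt_of_le_of_ne ht3 ht4
    have e3 : ((1 - a * t + (1 - a) * C * t : ℝ) : ℂ) = w * ((1 - a * t + (1 - a) * C : ℝ) : ℂ) := by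
      rw [htτ] at e2; push_cast; exact e2
    have e4 : |1 - a * t + (1 - a) * C * t| ≤ |1 - a * t + (1 - a) * C| := by
      have := congrArg norm e3
      rw [norm_mul, Complex.norm_real, Complex.norm_real, Real.norm_eq_abs, Real.norm_eq_abs] at this
      rw [this]
      exact mul_le_of_le_one_left (abs_nonneg _) hw
    have e5 := sq_le_sq.2 e4
    -- `e6` and `e7` are the difference and the sum of the two quantities compared in `e5`; their
    -- product contradicts it.
    have e6 : 0 < (1 - a) * (-C) * (1 - t) := mul_pos (mul_pos (by linarith) (by linarith)) (by linarith)
    have e7 : 0 < 2 * (1 - a * t) + (1 - a) * C * (1 + t) := by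
      have h1 : 0 ≤ (1 - a) * (1 + C) * (1 + t) :=
        mul_nonneg (mul_nonneg (by linarith) (by linarith)) (by linarith)
      have h2 : 0 < (1 + a) * (1 - t) := mul_pos (by linarith) (by linarith)
      nlinarith
    nlinarith [mul_pos e6 e7]
  · have hX : 0 < X := by
      have := mul_pos (show 0 < 1 - b by linarith) hC
      simp only [X]; linarith
    have hYX : |Y| < X := by
      have := mul_pos (show 0 < 1 - b by linarith) hC
      rw [abs_lt]
      simp only [X, Y]
      constructor <;> nlinarith
    have : |t| * |Y| = X := by rw [← abs_mul, htX, abs_of_pos hX]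
    nlinarith [abs_nonneg Y]

/-- With V = -U, mass and energy both contain (1 - κ)U; eliminating it leaves the factor of
`quadratic_ne_zero`. -/
theorem IsNull.add_ne_zero (hn : IsNull a b C w κ ρ U V) (h : Admissible a b C) (hw : ‖w‖ ≤ 1)
    (h0 : (ρ, U, V) ≠ 0) : U + V ≠ 0 := by
  intro hUV
  have hρ := hn.rho_ne_zero h hw h0
  obtain ⟨h1, h2, h3⟩ := hn
  obtain rfl : V = -U := by linear_combination hUV
  have : ρ * ((1 - w) * (1 + b * w) + 2 * ((1 - b) * C ^ 2) * w) = 0 := by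
    linear_combination (1 + b * w) * h1 - 2 * h3
  exact quadratic_ne_zero h.hb h.hC0 h.hC1 hw ((mul_eq_zero.1 this).resolve_left hρ)

theorem IsNull.eq_one_of_sub_eq_zero (hn : IsNull a b C w κ ρ U V) (h : Admissible a b C)
    (hw : ‖w‖ ≤ 1) (h0 : (ρ, U, V) ≠ 0) (hUV : U - V = 0) : w = 1 := by
  have hρ := hn.rho_ne_zero h hw h0
  have := hn.mass
  rw [hUV, mul_zero] at this
  exact (sub_eq_zero.1 ((mul_eq_zero.1 this).resolve_right hρ)).symm

/-- The product form is kept because the coefficient of κ may vanish when C > 0. -/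
theorem IsNull.kappa_mul_eq_of_sub_eq_zero (hn : IsNull a b C w κ ρ U V) (h : Admissible a b C)
    (hw : ‖w‖ ≤ 1) (h0 : (ρ, U, V) ≠ 0) (hUV : U - V = 0) :
    κ * (((1 + a) * C - (1 - a) : ℝ) : ℂ) = (((1 + a) * C + (1 - a) : ℝ) : ℂ) := by
  have hρ := hn.rho_ne_zero h hw h0
  obtain rfl := hn.eq_one_of_sub_eq_zero h hw h0 hUV
  obtain ⟨-, h2, h3⟩ := hn
  obtain rfl : V = U := by linear_combination -hUV
  have hCc : (C : ℂ) ≠ 0 := by exact_mod_cast h.hC0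
  have hb : (1 : ℂ) - b ≠ 0 := by
    have := h.one_sub_ne' (w := 1) (by simp); simpa using this
  have h3' : V * (1 + κ) = C ^ 2 * ρ := by
    refine mul_left_cancel₀ hb ?_
    linear_combination h3
  have hV : V ≠ 0 := by
    rintro rfl
    rw [zero_mul] at h3'
    exact mul_ne_zero (pow_ne_zero 2 hCc) hρ h3'.symm
  have : V * (κ * ((1 + a) * C - (1 - a)) - ((1 + a) * C + (1 - a))) = 0 := by
    linear_combination C * h2 - (1 - a) * h3'
  push_cast
  exact sub_eq_zero.1 ((mul_eq_zero.1 this).resolve_left hV)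

theorem Admissible.abs_sub_lt (h : Admissible a b C) (hC : 0 < C) :
    |(1 + a) * C - (1 - a)| < |(1 + a) * C + (1 - a)| := by
  obtain ⟨ha1, ha2⟩ := abs_lt.1 h.ha
  have := mul_pos (show 0 < 1 + a by linarith) hC
  rw [abs_of_pos (show 0 < (1 + a) * C + (1 - a) by linarith), abs_lt]
  constructor <;> linarith

theorem one_lt_norm_of_mul_eq (h : Admissible a b C) (hC : 0 < C)
    (e : κ * (((1 + a) * C - (1 - a) : ℝ) : ℂ) = (((1 + a) * C + (1 - a) : ℝ) : ℂ)) :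
    1 < ‖κ‖ := by
  have en := congrArg norm e
  rw [norm_mul, Complex.norm_real, Complex.norm_real, Real.norm_eq_abs, Real.norm_eq_abs] at en
  have := h.abs_sub_lt hC
  nlinarith [abs_nonneg ((1 + a) * C - (1 - a)), norm_nonneg κ]

theorem IsNull.sub_ne_zero (hn : IsNull a b C w κ ρ U V) (h : Admissible a b C) (hC : 0 < C)
    (hw : ‖w‖ ≤ 1) (hκ : ‖κ‖ ≤ 1) (h0 : (ρ, U, V) ≠ 0) : U - V ≠ 0 := fun hUV =>
  not_lt.2 hκ (one_lt_norm_of_mul_eq h hC (hn.kappa_mul_eq_of_sub_eq_zero h hw h0 hUV))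

/-! ### The roots at z = 1. -/

theorem leadCoeff_one (a b C : ℝ) :
    leadCoeff a b C 1 = (((1 - b) * C * ((1 + a) * C - (1 - a)) : ℝ) : ℂ) := by
  unfold leadCoeff; push_cast; ring

theorem charPoly_at_one (a b C : ℝ) (κ : ℂ) : charPoly a b C 1 κ = (1 - κ) * (((1 - b) * C : ℝ) *
    (((1 + a) * C + (1 - a) : ℝ) - κ * ((1 + a) * C - (1 - a) : ℝ))) := by
  unfold charPoly; push_cast; ring

/-- The root at `z = 1` other than `κ = 1`. -/
def otherRoot (a C : ℝ) : ℝ := ((1 + a) * C + (1 - a)) / ((1 + a) * C - (1 - a))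

theorem otherRoot_den (h : Admissible a b C) (hC : C < 0) : (1 + a) * C - (1 - a) < 0 := by
  obtain ⟨ha1, ha2⟩ := abs_lt.1 h.ha
  nlinarith [mul_pos (show 0 < 1 + a by linarith) (neg_pos.2 hC)]

theorem abs_lt_otherRoot_den (h : Admissible a b C) (hC : C < 0) :
    |(1 + a) * C + (1 - a)| < |(1 + a) * C - (1 - a)| := by
  obtain ⟨ha1, ha2⟩ := abs_lt.1 h.ha
  have := mul_pos (show 0 < 1 + a by linarith) (neg_pos.2 hC)
  rw [abs_of_neg (otherRoot_den h hC), abs_lt]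
  constructor <;> linarith

theorem abs_otherRoot_lt (h : Admissible a b C) (hC : C < 0) : |otherRoot a C| < 1 := by
  rw [otherRoot, abs_div, div_lt_one (abs_pos.2 (otherRoot_den h hC).ne)]
  exact abs_lt_otherRoot_den h hC

theorem Admissible.one_sub_mul_ne (h : Admissible a b C) : (1 - b) * C ≠ 0 :=
  mul_ne_zero (by linarith [(abs_lt.1 h.hb).2]) h.hC0

/-- In the closed disk κ = 1 is a root only for w = 1; there the modulus inequality of `stableGraph`
reads |(1 + a)C - (1 - a)| ≤ |(1 + a)C + (1 - a)|, false for outflow. -/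
theorem kappa_ne_one_of_mem (h : Admissible a b C) (hC : C < 0) (hm : (w, κ) ∈ stableGraph a b C) :
    κ ≠ 1 := by
  rintro rfl
  obtain ⟨hw, -, hD, hA⟩ := hm
  simp only at hw hD hA
  have hw1 : w = 1 := by
    by_contra hw1
    exact charPoly_one_ne_zero h hw hw1 hD
  subst hw1
  rw [leadCoeff_one, leadCoeff_one, norm_one, mul_one, Complex.norm_real, Complex.norm_real,
    Real.norm_eq_abs, Real.norm_eq_abs,
    show (1 - b) * -C * ((1 + a) * -C - (1 - a)) = (1 - b) * C * ((1 + a) * C + (1 - a)) by ring,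
    abs_mul, abs_mul ((1 - b) * C)] at hA
  exact absurd (le_of_mul_le_mul_left hA (abs_pos.2 h.one_sub_mul_ne))
    (not_le.2 (abs_lt_otherRoot_den h hC))

theorem eq_otherRoot_of_mem (h : Admissible a b C) (hC : C < 0)
    (hm : (1, κ) ∈ stableGraph a b C) : κ = otherRoot a C := by
  have hκ := kappa_ne_one_of_mem h hC hm
  have hD := hm.2.2.1
  simp only [charPoly_at_one] at hD
  have h1 := (mul_eq_zero.1 hD).resolve_left (_root_.sub_ne_zero.2 hκ.symm)
  have h2 := (mul_eq_zero.1 h1).resolve_left (by exact_mod_cast h.one_sub_mul_ne)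
  have hden : (((1 + a) * C - (1 - a) : ℝ) : ℂ) ≠ 0 := by
    exact_mod_cast (otherRoot_den h hC).ne
  rw [otherRoot, Complex.ofReal_div, eq_div_iff hden]
  linear_combination -h2

theorem eq_one_of_mem (h : Admissible a b C) (hC : 0 < C)
    (hm : (1, κ) ∈ stableGraph a b C) : κ = 1 := by
  obtain ⟨-, hκ, hD, -⟩ := hm
  simp only [charPoly_at_one] at hD hκ
  by_contra hne
  have h1 := (mul_eq_zero.1 hD).resolve_left (_root_.sub_ne_zero.2 (Ne.symm hne))
  have h2 := (mul_eq_zero.1 h1).resolve_left (by exact_mod_cast h.one_sub_mul_ne)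
  exact not_lt.2 hκ (one_lt_norm_of_mul_eq h hC (sub_eq_zero.1 h2).symm)

theorem isNull_otherRoot (h : Admissible a b C) (hC : C < 0) :
    IsNull a b C 1 (otherRoot a C) (1 + otherRoot a C) (C ^ 2) (C ^ 2) := by
  have hden : (((1 + a) * C - (1 - a) : ℝ) : ℂ) ≠ 0 := by
    exact_mod_cast (otherRoot_den h hC).ne
  have hr : ((otherRoot a C : ℝ) : ℂ) * ((1 + a) * C - (1 - a)) = (1 + a) * C + (1 - a) := by
    rw [otherRoot, Complex.ofReal_div]
    push_cast at hden ⊢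
    field_simp
  refine ⟨by ring, ?_, by ring⟩
  linear_combination C * hr

theorem isNull_one_one (a b C : ℝ) : IsNull a b C 1 1 2 (C ^ 2 + C) (C ^ 2 - C) :=
  ⟨by ring, by ring, by ring⟩

/-! ### The eigenvector along the stable root -/

/-- The ratio `U - V` for the eigenvector with `ρ = 1`. -/
def massRatio (a b C : ℝ) (w : ℂ) : ℂ := (1 - w) / (1 - stableRoot a b C w)

/-- The component `U` of the eigenvector with `ρ = 1` at the stable root. -/
def nullU (a b C : ℝ) (w : ℂ) : ℂ :=
  ((1 - a) * C * w - massRatio a b C w * (1 - a * w * stableRoot a b C w)) /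
    ((stableRoot a b C w - 1) * (1 + a * w))

/-- The component `V` of the eigenvector with `ρ = 1` at the stable root. -/
def nullV (a b C : ℝ) (w : ℂ) : ℂ := nullU a b C w - massRatio a b C w

/-- Mass and flux define `massRatio` and `nullU`; the energy equation then amounts to the
characteristic equation. -/
theorem isNull_stableRoot (h : Admissible a b C) (hw : ‖w‖ < 1) :
    IsNull a b C w (stableRoot a b C w) 1 (nullU a b C w) (nullV a b C w) := by
  have hκ := one_sub_ne_zero_of_norm_lt (norm_stableRoot_lt h hw)
  have hD := charPoly_stableRoot h hw
  have ha := h.one_add_ne hw.le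
  have hκ' : stableRoot a b C w - 1 ≠ 0 := by rw [← neg_sub]; exact neg_ne_zero.2 hκ
  have hV : nullV a b C w = nullU a b C w - massRatio a b C w := rfl
  have hG : massRatio a b C w * (1 - stableRoot a b C w) = 1 - w := by
    rw [massRatio]; field_simp
  have hU : nullU a b C w * ((stableRoot a b C w - 1) * (1 + a * w))
      = (1 - a) * C * w - massRatio a b C w * (1 - a * w * stableRoot a b C w) := by
    rw [nullU]; field_simp
  rw [hV]
  generalize nullU a b C w = U at *
  generalize massRatio a b C w = G at *
  generalize stableRoot a b C w = κ at *
  refine ⟨by linear_combination -hG, by linear_combination hU, ?_⟩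
  rw [← sub_eq_zero]
  refine (mul_eq_zero.1 (show ((κ - 1) * (1 + a * w) * (1 - κ)) * _ = 0 from ?_)).resolve_left
    (mul_ne_zero (mul_ne_zero hκ' ha) hκ)
  unfold charPoly at hD
  linear_combination hD + (1 - κ) * (1 + κ) * (1 - b * w) * hU
    + (-(1 + κ) * (1 - b * w) * (1 - a * w * κ) - (1 - b * w * κ) * (κ - 1) * (1 + a * w)) * hG

theorem differentiableOn_massRatio (h : Admissible a b C) :
    DifferentiableOn ℂ (massRatio a b C) (Metric.ball 0 1) := by
  refine DifferentiableOn.div (by fun_prop) ((differentiableOn_const _).sub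
    (differentiableOn_stableRoot h)) fun w hw => ?_
  exact one_sub_ne_zero_of_norm_lt (norm_stableRoot_lt h (by simpa using hw))

theorem differentiableOn_nullU (h : Admissible a b C) :
    DifferentiableOn ℂ (nullU a b C) (Metric.ball 0 1) := by
  have h1 := differentiableOn_massRatio h
  have h2 := differentiableOn_stableRoot h
  refine DifferentiableOn.div (by fun_prop) (by fun_prop) fun w hw => ?_
  have hw : ‖w‖ < 1 := by simpa using hw
  refine mul_ne_zero ?_ (h.one_add_ne hw.le)
  rw [← neg_sub]
  exact neg_ne_zero.2 (one_sub_ne_zero_of_norm_lt (norm_stableRoot_lt h hw))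

theorem differentiableOn_nullV (h : Admissible a b C) :
    DifferentiableOn ℂ (nullV a b C) (Metric.ball 0 1) :=
  (differentiableOn_nullU h).sub (differentiableOn_massRatio h)

/-- A functional that does not vanish on the eigenvectors at the limit points of the stable root
controls the eigenvectors uniformly (the uniform Kreiss-Lopatinskii condition). -/
theorem exists_bound_of_ne_zero {L : ℂ → ℂ → ℂ → ℂ → ℂ}
    (hL : Continuous fun p : (ℂ × ℂ) × ℂ × ℂ × ℂ => L p.1.2 p.2.1 p.2.2.1 p.2.2.2)
    (hom : ∀ κ ρ U V t, L κ (t * ρ) (t * U) (t * V) = t * L κ ρ U V)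
    (h0 : ∀ w κ ρ U V, (w, κ) ∈ stableGraph a b C → IsNull a b C w κ ρ U V → (ρ, U, V) ≠ 0 →
      L κ ρ U V ≠ 0) :
    ∃ B : ℝ, 0 < B ∧ ∀ w κ ρ U V, (w, κ) ∈ stableGraph a b C → IsNull a b C w κ ρ U V →
      ‖(ρ, U, V)‖ ≤ B * ‖L κ ρ U V‖ := by
  set K : Set ((ℂ × ℂ) × ℂ × ℂ × ℂ) := (stableGraph a b C ×ˢ Metric.sphere 0 1) ∩
    {p | IsNull a b C p.1.1 p.1.2 p.2.1 p.2.2.1 p.2.2.2} with hKdef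
  have hK : IsCompact K := by
    refine ((isCompact_stableGraph a b C).prod (isCompact_sphere _ _)).inter_right ?_
    have : {p : (ℂ × ℂ) × ℂ × ℂ × ℂ | IsNull a b C p.1.1 p.1.2 p.2.1 p.2.2.1 p.2.2.2}
        = {p : (ℂ × ℂ) × ℂ × ℂ × ℂ | (1 - p.1.1) * p.2.1 = (1 - p.1.2) * (p.2.2.1 - p.2.2.2)} ∩
          ({p : (ℂ × ℂ) × ℂ × ℂ × ℂ | p.2.2.1 * (p.1.2 - a * p.1.1) - p.2.2.2 * (1 - a * p.1.1 * p.1.2)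
            = (1 - a) * C * p.1.1 * p.2.1} ∩
          {p : (ℂ × ℂ) × ℂ × ℂ × ℂ | p.2.2.1 * (p.1.2 - b * p.1.1) + p.2.2.2 * (1 - b * p.1.1 * p.1.2)
            = (1 - b) * C ^ 2 * p.1.1 * p.2.1}) := by
      ext p
      exact ⟨fun h => ⟨h.1, h.2, h.3⟩, fun h => ⟨h.1, h.2.1, h.2.2⟩⟩
    rw [this]
    exact (isClosed_eq (by fun_prop) (by fun_prop)).inter
      ((isClosed_eq (by fun_prop) (by fun_prop)).inter (isClosed_eq (by fun_prop) (by fun_prop)))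
  have hcont : ContinuousOn (fun p : (ℂ × ℂ) × ℂ × ℂ × ℂ =>
      ‖L p.1.2 p.2.1 p.2.2.1 p.2.2.2‖⁻¹) K := by
    refine ContinuousOn.inv₀ hL.norm.continuousOn fun p hp => norm_ne_zero_iff.2 ?_
    refine h0 p.1.1 p.1.2 _ _ _ hp.1.1 hp.2 fun h => ?_
    have := mem_sphere_zero_iff_norm.1 hp.1.2
    rw [show p.2 = 0 from h] at this
    simp at this
  obtain ⟨B, hB⟩ := hK.bddAbove_image hcont
  refine ⟨max B 1, by positivity, fun w κ ρ U V hm hn => ?_⟩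
  by_cases hz : (ρ, U, V) = 0
  · rw [hz]; simp only [norm_zero]; positivity
  set N : ℝ := ‖(ρ, U, V)‖ with hN
  have hN0 : 0 < N := norm_pos_iff.2 hz
  have hNc : (N : ℂ) ≠ 0 := by exact_mod_cast hN0.ne'
  have hmem : (((w, κ), ((N : ℂ)⁻¹ * ρ, (N : ℂ)⁻¹ * U, (N : ℂ)⁻¹ * V)) : (ℂ × ℂ) × ℂ × ℂ × ℂ) ∈ K := by
    refine ⟨⟨hm, ?_⟩, hn.smul _⟩
    have : (((N : ℂ)⁻¹ * ρ, (N : ℂ)⁻¹ * U, (N : ℂ)⁻¹ * V) : ℂ × ℂ × ℂ) = (N : ℂ)⁻¹ • (ρ, U, V) := by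
      simp
    simp only [mem_sphere_zero_iff_norm]
    rw [this, norm_smul, ← hN, norm_inv, Complex.norm_real, Real.norm_of_nonneg hN0.le]
    field_simp
  have := hB ⟨_, hmem, rfl⟩
  simp only [hom, norm_mul, norm_inv, Complex.norm_real, Real.norm_of_nonneg hN0.le, mul_inv,
    inv_inv] at this
  have hL0 : 0 < ‖L κ ρ U V‖ := norm_pos_iff.2 (h0 w κ ρ U V hm hn hz)
  rw [← div_eq_mul_inv, div_le_iff₀ hL0] at this
  exact this.trans (by gcongr; exact le_max_left _ _)

end

/-! ### Power series on the unit disk and the norm of a convolution operator -/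

/-- `c` is the sequence of the Taylor coefficients at `0` of `h`, holomorphic on the unit disk. -/
def HasTaylor (c : ℕ → ℂ) (h : ℂ → ℂ) : Prop :=
  ∀ w : ℂ, ‖w‖ < 1 → HasSum (fun n => c n * w ^ n) (h w)

/-- The causal convolution of two sequences. -/
def conv (c d : ℕ → ℂ) (n : ℕ) : ℂ := ∑ p ∈ Finset.HasAntidiagonal.antidiagonal n, c p.1 * d p.2

theorem exists_hasTaylor {h : ℂ → ℂ} (hd : DifferentiableOn ℂ h (Metric.ball 0 1)) :
    ∃ c, HasTaylor c h := by
  refine ⟨fun n => (n.factorial : ℂ)⁻¹ * iteratedDeriv n h 0, fun w hw => ?_⟩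
  refine (Complex.hasSum_taylorSeries_on_ball hd (z := w) (by simpa using hw)).congr_fun ?_
  intro n
  simp only [sub_zero, smul_eq_mul]; ring

namespace HasTaylor

variable {c d : ℕ → ℂ} {h k : ℂ → ℂ}

theorem summable_norm (hc : HasTaylor c h) {w : ℂ} (hw : ‖w‖ < 1) :
    Summable fun n => ‖c n * w ^ n‖ :=
  (hc w hw).summable.norm

theorem eq_zero (hc : HasTaylor c fun _ => 0) : c = 0 := by
  have : HasFPowerSeriesAt (0 : ℂ → ℂ) (FormalMultilinearSeries.ofScalars ℂ c) 0 := by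
    rw [hasFPowerSeriesAt_iff]
    filter_upwards [Metric.ball_mem_nhds (0 : ℂ) one_pos] with w hw
    simpa [FormalMultilinearSeries.coeff_ofScalars, mul_comm] using hc w (by simpa using hw)
  ext n
  rw [← FormalMultilinearSeries.coeff_ofScalars (𝕜 := ℂ) (p := c) (n := n), this.eq_zero]
  rfl

theorem add (hc : HasTaylor c h) (hd : HasTaylor d k) : HasTaylor (c + d) (h + k) := fun w hw => by
  simpa [add_mul] using (hc w hw).add (hd w hw)

theorem unique (hc : HasTaylor c h) (hd : HasTaylor d k) (hk : ∀ w, ‖w‖ < 1 → h w = k w) :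
    c = d := by
  have : HasTaylor (fun n => c n - d n) fun _ => 0 := fun w hw => by
    simpa [sub_mul, hk w hw] using (hc w hw).sub (hd w hw)
  ext n
  exact sub_eq_zero.1 (congrFun this.eq_zero n)

theorem shift (hc : HasTaylor c h) :
    HasTaylor (fun n => match n with | 0 => 0 | n + 1 => c n) (fun w => w * h w) := fun w hw => by
  rw [← hasSum_nat_add_iff' 1]
  simpa [pow_succ', mul_left_comm] using (hc w hw).mul_left w

theorem conv (hc : HasTaylor c h) (hd : HasTaylor d k) :
    HasTaylor (D1Q3.conv c d) (fun w => h w * k w) := fun w hw => by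
  have h1 := hc.summable_norm hw
  have h2 := hd.summable_norm hw
  have e : (fun n => D1Q3.conv c d n * w ^ n) = fun n => ∑ p ∈ Finset.HasAntidiagonal.antidiagonal n,
      (c p.1 * w ^ p.1) * (d p.2 * w ^ p.2) := by
    ext n
    rw [D1Q3.conv, Finset.sum_mul]
    refine Finset.sum_congr rfl fun p hp => ?_
    rw [← Finset.HasAntidiagonal.mem_antidiagonal.1 hp, pow_add]; ring
  change HasSum _ (h w * k w)
  rw [e, ← (hc w hw).tsum_eq, ← (hd w hw).tsum_eq,
    tsum_mul_tsum_eq_tsum_sum_antidiagonal_of_summable_norm h1 h2]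
  exact (summable_norm_sum_mul_antidiagonal_of_summable_norm h1 h2).of_norm.hasSum

end HasTaylor

theorem fourier_nat {T : ℝ} (n : ℕ) (t : AddCircle T) :
    fourier (n : ℤ) t = (fourier 1 t : ℂ) ^ n := by
  rw [fourier_apply, fourier_apply, one_zsmul, natCast_zsmul, AddCircle.toCircle_nsmul]
  simp

theorem orthonormal_fourier_nat :
    Orthonormal ℂ fun n : ℕ => (fourierLp 2 (n : ℤ) : MeasureTheory.Lp ℂ 2
      (AddCircle.haarAddCircle (T := 1))) :=
  orthonormal_fourier.comp _ Nat.cast_injective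

/-- Convolution with the Taylor coefficients of `h` is bounded by the supremum of `‖h‖` on the
circle of radius `r`, in the `ℓ²` norm with weights `r ^ n`. -/
theorem sum_conv_le {c : ℕ → ℂ} {h : ℂ → ℂ} (hc : HasTaylor c h) {r B : ℝ} (hr0 : 0 ≤ r)
    (hr1 : r < 1) (hB : ∀ w, ‖w‖ = r → ‖h w‖ ≤ B) (g : ℕ → ℂ) (N : ℕ) :
    ∑ n ∈ Finset.range N, (r ^ n * ‖conv c g n‖) ^ 2
      ≤ B ^ 2 * ∑ n ∈ Finset.range N, (r ^ n * ‖g n‖) ^ 2 := by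
  -- By causality, truncating the source at N does not change the first N outputs, and it makes the
  -- generating function a polynomial.
  set d : ℕ → ℂ := fun n => if n ∈ Finset.range N then g n else 0 with hd
  have hconv : ∀ n ∈ Finset.range N, conv c g n = conv c d n := fun n hn => by
    refine Finset.sum_congr rfl fun p hp => ?_
    have : p.2 ∈ Finset.range N := by
      have := Finset.HasAntidiagonal.mem_antidiagonal.1 hp
      rw [Finset.mem_range] at hn ⊢; omega
    simp only [hd, if_pos this]
  have hdT : HasTaylor d fun w => ∑ n ∈ Finset.range N, g n * w ^ n := fun w _ => by
    have : ∑ n ∈ Finset.range N, g n * w ^ n = ∑ n ∈ Finset.range N, d n * w ^ n :=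
      Finset.sum_congr rfl fun n hn => by simp only [hd, if_pos hn]
    simp only [this]
    exact hasSum_sum_of_ne_finset_zero fun n hn => by simp only [hd, if_neg hn, zero_mul]
  have hy := hc.conv hdT
  set y := conv c d with hydef
  set μ := AddCircle.haarAddCircle (T := 1)
  set e : ℕ → MeasureTheory.Lp ℂ 2 μ := fun n => fourierLp 2 (n : ℤ) with he
  have hon : Orthonormal ℂ e := orthonormal_fourier_nat
  let Λ : C(AddCircle (1 : ℝ), ℂ) →L[ℂ] MeasureTheory.Lp ℂ 2 μ := ContinuousMap.toLp 2 μ ℂ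
  -- The sum Y is the generating function of y on the circle of radius r. Its Fourier coefficients
  -- are y n r^n, so Bessel's inequality bounds the first N of them by its L² norm.
  have hsum : Summable fun n : ℕ =>
      (y n * (r : ℂ) ^ n) • (fourier (n : ℤ) : C(AddCircle (1 : ℝ), ℂ)) := by
    refine Summable.of_norm ?_
    refine (hy.summable_norm (w := (r : ℂ)) (by simpa [abs_of_nonneg hr0] using hr1)).congr ?_
    intro n
    rw [norm_smul, fourier_norm, mul_one]
  obtain ⟨Y, hY⟩ := hsum
  set G : C(AddCircle (1 : ℝ), ℂ) := ∑ n ∈ Finset.range N, (g n * (r : ℂ) ^ n) • fourier (n : ℤ)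
    with hG
  have hpt : ∀ t, ‖Y t‖ ≤ B * ‖G t‖ := by
    intro t
    set w : ℂ := r * fourier 1 t with hw
    have hwn : ‖w‖ = r := by
      rw [hw, norm_mul, Complex.norm_real, Real.norm_of_nonneg hr0, fourier_apply,
        Circle.norm_coe, mul_one]
    have h1 : HasSum (fun n => y n * w ^ n) (Y t) := by
      refine (ContinuousMap.hasSum_apply hY t).congr_fun fun n => ?_
      simp only [ContinuousMap.smul_apply, smul_eq_mul, fourier_nat, hw]; ring
    have h2 : Y t = h w * ∑ n ∈ Finset.range N, g n * w ^ n :=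
      h1.unique (hy w (hwn ▸ hr1))
    have h3 : G t = ∑ n ∈ Finset.range N, g n * w ^ n := by
      rw [hG, ContinuousMap.sum_apply]
      refine Finset.sum_congr rfl fun n _ => ?_
      simp only [ContinuousMap.smul_apply, smul_eq_mul, fourier_nat, hw]; ring
    rw [h2, h3, norm_mul]
    exact mul_le_mul_of_nonneg_right (hB w hwn) (norm_nonneg _)
  have hle : ‖Λ Y‖ ≤ B * ‖Λ G‖ := by
    refine MeasureTheory.Lp.norm_le_mul_norm_of_ae_le_mul ?_
    filter_upwards [ContinuousMap.coeFn_toLp (p := 2) (𝕜 := ℂ) μ Y,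
      ContinuousMap.coeFn_toLp (p := 2) (𝕜 := ℂ) μ G] with t h1 h2
    simp only [Λ, h1, h2, hpt t]
  have hinner : ∀ m, inner ℂ (e m) (Λ Y) = y m * (r : ℂ) ^ m := by
    intro m
    have h1 := (hY.mapL Λ).mapL (innerSL ℂ (e m))
    refine h1.unique ?_
    have : ∀ n, (innerSL ℂ (e m)) (Λ ((y n * (r : ℂ) ^ n) • fourier (n : ℤ)))
        = if n = m then y m * (r : ℂ) ^ m else 0 := by
      intro n
      rw [map_smul, map_smul, innerSL_apply_apply, show Λ (fourier (n : ℤ)) = e n from rfl,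
        orthonormal_iff_ite.1 hon m n]
      by_cases hnm : m = n
      · simp [hnm]
      · simp [hnm, Ne.symm hnm]
    simp only [this]
    exact hasSum_ite_eq m _
  have hGn : ‖Λ G‖ ^ 2 = ∑ n ∈ Finset.range N, (r ^ n * ‖g n‖) ^ 2 := by
    have : Λ G = ∑ n ∈ Finset.range N, (g n * (r : ℂ) ^ n) • e n := by
      rw [hG, map_sum]
      exact Finset.sum_congr rfl fun n _ => map_smul _ _ _
    have h2 := @inner_self_eq_norm_sq_to_K ℂ _ _ _ _ (Λ G)
    rw [this, hon.inner_sum, ← this] at h2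
    have h3 : ((‖Λ G‖ ^ 2 : ℝ) : ℂ) = ((∑ n ∈ Finset.range N, (r ^ n * ‖g n‖) ^ 2 : ℝ) : ℂ) := by
      rw [Complex.ofReal_pow]
      refine h2.symm.trans ?_
      rw [Complex.ofReal_sum]
      refine Finset.sum_congr rfl fun n _ => ?_
      rw [Complex.conj_mul', norm_mul, norm_pow, Complex.norm_real, Real.norm_of_nonneg hr0]
      push_cast; ring
    exact_mod_cast h3
  have hB0 : ∀ n : ℕ, 0 ≤ (r ^ n * ‖g n‖) ^ 2 := fun n => sq_nonneg _
  calc ∑ n ∈ Finset.range N, (r ^ n * ‖conv c g n‖) ^ 2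
      = ∑ n ∈ Finset.range N, ‖inner ℂ (e n) (Λ Y)‖ ^ 2 := by
        refine Finset.sum_congr rfl fun n hn => ?_
        rw [hinner, hconv n hn, norm_mul, norm_pow, Complex.norm_real, Real.norm_of_nonneg hr0,
          mul_comm]
    _ ≤ ‖Λ Y‖ ^ 2 := hon.sum_inner_products_le _
    _ ≤ (B * ‖Λ G‖) ^ 2 := by gcongr
    _ = B ^ 2 * ∑ n ∈ Finset.range N, (r ^ n * ‖g n‖) ^ 2 := by rw [mul_pow, hGn]

/-! ### The solution with zero initial data -/

section LinStep

variable {E F : Type*} [AddCommGroup E] [Module ℝ E] [AddCommGroup F] [Module ℝ F]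

/-- The scheme for data with values in a real vector space. -/
def linStep (C : ℝ) (s : Fin 3 → ℝ) (bc : BoundaryCondition) (g : E) (m : ℕ → Fin 3 → E) (j : ℕ)
    (i : Fin 3) : E :=
  ∑ k, momentMatrix i k • if velocity k ≤ (j : ℤ) then
      ∑ l, postRelaxation C s k l • m ((j : ℤ) - velocity k).toNat l
    else ∑ ℓ, ∑ h ∈ Finset.range bc.width,
      bc.weight ℓ h • ∑ l, postRelaxation C s ℓ l • m h l + g

theorem step_eq_linStep (C : ℝ) (s : Fin 3 → ℝ) (bc : BoundaryCondition) (g : ℝ)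
    (m : ℕ → Fin 3 → ℝ) (j : ℕ) (i : Fin 3) :
    step C s bc g m j i = linStep C s bc g m j i := by
  simp only [step, linStep, mulVec, dotProduct, BoundaryCondition.ghost, smul_eq_mul]

/-- One commutation rule serves for complexification, evaluation at w, convolution with the source
and division by the Lopatinskii functional. -/
theorem map_linStep (T : E →ₗ[ℝ] F) (C : ℝ) (s : Fin 3 → ℝ) (bc : BoundaryCondition) (g : E)
    (m : ℕ → Fin 3 → E) (j : ℕ) (i : Fin 3) :
    T (linStep C s bc g m j i) = linStep C s bc (T g) (fun j i => T (m j i)) j i := by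
  simp only [linStep, map_sum, map_smul, apply_ite T, map_add]

theorem linStep_mem (S : Submodule ℝ E) (C : ℝ) (s : Fin 3 → ℝ) (bc : BoundaryCondition) {g : E}
    {m : ℕ → Fin 3 → E} (hg : g ∈ S) (hm : ∀ j i, m j i ∈ S) (j : ℕ) (i : Fin 3) :
    linStep C s bc g m j i ∈ S := by
  refine S.sum_mem fun k _ => S.smul_mem _ ?_
  split_ifs
  · exact S.sum_mem fun l _ => S.smul_mem _ (hm _ _)
  · exact S.add_mem (S.sum_mem fun ℓ _ => S.sum_mem fun h _ => S.smul_mem _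
      (S.sum_mem fun l _ => S.smul_mem _ (hm _ _))) hg

end LinStep

/-- The pairs of a sequence of Taylor coefficients and of the function on the unit disk. -/
def taylorPairs : Submodule ℝ ((ℕ → ℂ) × (ℂ → ℂ)) where
  carrier := {p | HasTaylor p.1 p.2}
  add_mem' := fun hp hq => hp.add hq
  zero_mem' := fun w _ => by simp
  smul_mem' := fun t p hp w hw => by
    simpa [mul_assoc] using (hp w hw).mul_left (t : ℂ)

theorem HasTaylor.linStep {C : ℝ} {s : Fin 3 → ℝ} {bc : BoundaryCondition} {d : ℕ → ℂ} {k : ℂ → ℂ}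
    {c : ℕ → Fin 3 → ℕ → ℂ} {h : ℕ → Fin 3 → ℂ → ℂ} (hd : HasTaylor d k)
    (hc : ∀ j i, HasTaylor (c j i) (h j i)) (j : ℕ) (i : Fin 3) :
    HasTaylor (D1Q3.linStep C s bc d c j i)
      fun w => D1Q3.linStep C s bc (k w) (fun j i => h j i w) j i := by
  have := linStep_mem taylorPairs C s bc (g := (d, k)) (m := fun j i => (c j i, h j i)) hd hc j i
  have h1 := map_linStep (LinearMap.fst ℝ (ℕ → ℂ) (ℂ → ℂ)) C s bc (d, k)
    (fun j i => (c j i, h j i)) j i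
  have h2 : ∀ w, D1Q3.linStep C s bc (k w) (fun j i => h j i w) j i
      = (D1Q3.linStep C s bc (d, k) (fun j i => (c j i, h j i)) j i).2 w := fun w =>
    (map_linStep ((LinearMap.proj w : (ℂ → ℂ) →ₗ[ℝ] ℂ) ∘ₗ LinearMap.snd ℝ (ℕ → ℂ) (ℂ → ℂ)) C s bc
      (d, k) (fun j i => (c j i, h j i)) j i).symm
  simp only [h2]
  rw [show D1Q3.linStep C s bc d c j i = _ from h1.symm]
  exact this

/-- Convolution with a fixed sequence, at the time `n`, as a linear map. -/
def convLin (g : ℕ → ℂ) (n : ℕ) : (ℕ → ℂ) →ₗ[ℝ] ℂ where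
  toFun c := conv c g n
  map_add' c d := by simp [conv, add_mul, Finset.sum_add_distrib]
  map_smul' t c := by simp [conv, Finset.mul_sum, mul_assoc]

theorem conv_shift (d g : ℕ → ℂ) (n : ℕ) :
    conv (fun n => match n with | 0 => 0 | n + 1 => d n) g (n + 1) = conv d g n := by
  simp [conv, Finset.Nat.antidiagonal_succ]

theorem conv_single (g : ℕ → ℂ) (n : ℕ) : conv (Pi.single 0 1) g n = g n := by
  rw [conv, Finset.sum_eq_single (0, n)]
  · simp
  · intro p hp hne
    have h1 := Finset.HasAntidiagonal.mem_antidiagonal.1 hp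
    have : p.1 ≠ 0 := fun h0 => hne (by ext <;> simp [h0]; omega)
    simp [this]
  · simp

/-! ### Bulk modes as solutions of the scheme. -/

theorem inv_momentMatrix : momentMatrix⁻¹ = !![1, 0, -1; 0, 1 / 2, 1 / 2; 0, -1 / 2, 1 / 2] := by
  refine Matrix.inv_eq_right_inv ?_
  rw [momentMatrix, Matrix.mul_fin_three, Matrix.one_fin_three]
  norm_num

/-- The parameter s₁ drops out because the first moment is conserved by relaxation. -/
theorem postRelaxation_eq (a b C s₁ : ℝ) : postRelaxation C ![s₁, 1 - a, 1 - b]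
    = !![1 - (1 - b) * C ^ 2, 0, -b;
        ((1 - b) * C ^ 2 + (1 - a) * C) / 2, a / 2, b / 2;
        ((1 - b) * C ^ 2 - (1 - a) * C) / 2, -a / 2, b / 2] := by
  rw [postRelaxation, inv_momentMatrix]
  ext i j
  fin_cases i <;> fin_cases j <;>
    simp [relaxation, equilibrium, Matrix.mul_apply, Fin.sum_univ_three, vecMulVec,
      Matrix.one_apply, diagonal, Matrix.add_apply, Matrix.sub_apply] <;> ring

/-- The vector of moments of a bulk mode, up to the factor `w κ ^ j`. -/
def modeVec (κ ρ U V : ℂ) : Fin 3 → ℂ := ![ρ, U - κ * V, U + κ * V]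

/-- The post-relaxation distribution functions of a bulk mode, up to the factor `κ ^ j`. -/
def postVec (κ ρ U V : ℂ) : Fin 3 → ℂ := ![ρ - U - κ * V, κ * U, V]

/-- The Lopatinskii functional: the ghost value of a bulk mode minus the value prescribed by the
boundary condition without source. -/
def BoundaryCondition.lop (bc : BoundaryCondition) (κ ρ U V : ℂ) : ℂ :=
  U - ∑ ℓ, ∑ h ∈ Finset.range bc.width, (bc.weight ℓ h : ℂ) * (κ ^ h * postVec κ ρ U V ℓ)

section

variable {a b C s₁ : ℝ} {w κ ρ U V : ℂ}

theorem IsNull.postRelaxation_modeVec (hn : IsNull a b C w κ ρ U V) (k : Fin 3) :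
    ∑ l, (postRelaxation C ![s₁, 1 - a, 1 - b] k l : ℂ) * (w * modeVec κ ρ U V l)
      = postVec κ ρ U V k := by
  obtain ⟨h1, h2, h3⟩ := hn
  rw [postRelaxation_eq]
  fin_cases k <;> simp [Fin.sum_univ_three, modeVec, postVec]
  · linear_combination -h1 + h3
  · linear_combination (-h2 - h3) / 2
  · linear_combination (h2 - h3) / 2

/-- A bulk mode solves the scheme with source equal to the value of the Lopatinskii functional. -/
theorem IsNull.linStep_mode (hn : IsNull a b C w κ ρ U V) (bc : BoundaryCondition) (j : ℕ)
    (i : Fin 3) :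
    linStep C ![s₁, 1 - a, 1 - b] bc (bc.lop κ ρ U V)
      (fun j i => w * κ ^ j * modeVec κ ρ U V i) j i = κ ^ j * modeVec κ ρ U V i := by
  have hpost : ∀ j k, ∑ l, postRelaxation C ![s₁, 1 - a, 1 - b] k l •
      (w * κ ^ j * modeVec κ ρ U V l) = κ ^ j * postVec κ ρ U V k := fun j k => by
    rw [← hn.postRelaxation_modeVec (s₁ := s₁) k, Finset.mul_sum]
    refine Finset.sum_congr rfl fun l _ => ?_
    rw [Complex.real_smul]; ring
  simp only [linStep, hpost]
  simp only [Complex.real_smul]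
  have hg : ∑ ℓ, ∑ h ∈ Finset.range bc.width,
      (bc.weight ℓ h : ℂ) * (κ ^ h * postVec κ ρ U V ℓ) + bc.lop κ ρ U V = U := by
    rw [BoundaryCondition.lop]; ring
  simp only [hg]
  rcases j with _ | j
  · fin_cases i <;> simp [Fin.sum_univ_three, velocity, momentMatrix, modeVec, postVec] <;> ring
  · have e : ((j : ℤ) + 1 + 1).toNat = j + 2 := by omega
    have e' : ((j : ℤ) + 1).toNat = j + 1 := by omega
    have e1 : (0 : ℤ) ≤ (j : ℤ) + 1 := by omega
    have e2 : (-1 : ℤ) ≤ (j : ℤ) + 1 := by omega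
    fin_cases i <;>
      simp [Fin.sum_univ_three, velocity, momentMatrix, modeVec, postVec, e, e', e1, e2] <;> ring

/-- The generating function in time of the moments, for the source `1, 0, 0, …`. -/
def modeFun (a b C : ℝ) (bc : BoundaryCondition) (j : ℕ) (i : Fin 3) (w : ℂ) : ℂ :=
  w * stableRoot a b C w ^ j * modeVec (stableRoot a b C w) 1 (nullU a b C w) (nullV a b C w) i /
    bc.lop (stableRoot a b C w) 1 (nullU a b C w) (nullV a b C w)

theorem differentiableOn_modeFun (h : Admissible a b C) (bc : BoundaryCondition)
    (h0 : ∀ w, ‖w‖ < 1 → bc.lop (stableRoot a b C w) 1 (nullU a b C w) (nullV a b C w) ≠ 0)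
    (j : ℕ) (i : Fin 3) : DifferentiableOn ℂ (modeFun a b C bc j i) (Metric.ball 0 1) := by
  have h1 := differentiableOn_stableRoot h
  have h2 := differentiableOn_nullU h
  have h3 := differentiableOn_nullV h
  have h4 : DifferentiableOn ℂ (fun w => modeVec (stableRoot a b C w) 1 (nullU a b C w)
      (nullV a b C w) i) (Metric.ball 0 1) := by
    fin_cases i <;> simp [modeVec] <;> fun_prop
  have h5 : ∀ ℓ, DifferentiableOn ℂ (fun w => postVec (stableRoot a b C w) 1 (nullU a b C w)
      (nullV a b C w) ℓ) (Metric.ball 0 1) := by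
    intro ℓ
    fin_cases ℓ <;> simp [postVec] <;> fun_prop
  refine DifferentiableOn.div (by fun_prop) ?_ fun w hw => h0 w (by simpa using hw)
  refine h2.sub (DifferentiableOn.fun_sum fun ℓ _ => DifferentiableOn.fun_sum fun n _ => ?_)
  exact (differentiableOn_const _).mul ((h1.pow n).mul (h5 ℓ))

theorem modeFun_eq (h : Admissible a b C) (bc : BoundaryCondition) (hw : ‖w‖ < 1)
    (h0 : bc.lop (stableRoot a b C w) 1 (nullU a b C w) (nullV a b C w) ≠ 0) (j : ℕ) (i : Fin 3) :
    modeFun a b C bc j i w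
      = w * linStep C ![s₁, 1 - a, 1 - b] bc 1 (fun j i => modeFun a b C bc j i w) j i := by
  set Λ := bc.lop (stableRoot a b C w) 1 (nullU a b C w) (nullV a b C w) with hΛ
  have h1 := (isNull_stableRoot h hw).linStep_mode (s₁ := s₁) bc j i
  have h2 := map_linStep (LinearMap.mulRight ℝ Λ⁻¹) C ![s₁, 1 - a, 1 - b] bc Λ
    (fun j i => w * stableRoot a b C w ^ j *
      modeVec (stableRoot a b C w) 1 (nullU a b C w) (nullV a b C w) i) j i
  simp only [LinearMap.mulRight_apply, mul_inv_cancel₀ h0] at h2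
  simp only [modeFun, ← hΛ, div_eq_mul_inv]
  rw [← h2, h1]; ring

theorem hasTaylor_single : HasTaylor (Pi.single 0 1) fun _ => 1 := fun w _ => by
  convert hasSum_ite_eq (0 : ℕ) (1 : ℂ) using 2 with n
  by_cases hn : n = 0 <;> simp [hn]

/-- The solution with zero initial data is the convolution of the source with the Taylor
coefficients of `modeFun`. -/
theorem exists_moments_eq_conv (h : Admissible a b C) (bc : BoundaryCondition)
    (h0 : ∀ w, ‖w‖ < 1 → bc.lop (stableRoot a b C w) 1 (nullU a b C w) (nullV a b C w) ≠ 0) :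
    ∃ c : ℕ → Fin 3 → ℕ → ℂ, (∀ j i, HasTaylor (c j i) (modeFun a b C bc j i)) ∧
      ∀ g n j i, (moments C ![s₁, 1 - a, 1 - b] bc g n j i : ℂ) = conv (c j i) (fun n => g n) n := by
  choose c hc using fun j i => exists_hasTaylor (differentiableOn_modeFun h bc h0 j i)
  refine ⟨c, hc, fun g => ?_⟩
  -- Multiplication by w is a shift in time, so `modeFun_eq` says that the coefficients are the
  -- response to the unit impulse; convolution with g then gives the solution.
  have hrec : ∀ j i, c j i = fun n => match n with
      | 0 => 0
      | n + 1 => linStep C ![s₁, 1 - a, 1 - b] bc (Pi.single 0 1) c j i n := fun j i =>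
    (hc j i).unique ((hasTaylor_single.linStep hc j i).shift) fun w hw =>
      modeFun_eq h bc hw (h0 w hw) j i
  intro n
  induction n with
  | zero =>
    intro j i
    rw [hrec j i]
    simp [conv, moments]
  | succ n ih =>
    intro j i
    have h1 := map_linStep (convLin (fun n => g n) n) C ![s₁, 1 - a, 1 - b] bc (Pi.single 0 1) c j i
    have h2 := map_linStep Complex.ofRealCLM.toLinearMap C ![s₁, 1 - a, 1 - b] bc (g n)
      (moments C ![s₁, 1 - a, 1 - b] bc g n) j i
    have h3 : ∀ c, convLin (fun n => g n) n c = conv c (fun n => g n) n := fun _ => rfl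
    simp only [h3, conv_single] at h1
    rw [hrec j i, conv_shift, h1, moments, step_eq_linStep]
    simp only [← ih]
    exact h2

end

/-! ### The Lopatinskii functionals -/

theorem lop_bounceBack (κ ρ U V : ℂ) : bounceBack.lop κ ρ U V = U - V := by
  simp [BoundaryCondition.lop, bounceBack, postVec, Fin.sum_univ_three]

theorem lop_antiBounceBack (κ ρ U V : ℂ) : antiBounceBack.lop κ ρ U V = U + V := by
  simp [BoundaryCondition.lop, antiBounceBack, postVec, Fin.sum_univ_three]

theorem lop_twoStepsAntiBounceBack (κ ρ U V : ℂ) : twoStepsAntiBounceBack.lop κ ρ U V = ρ := by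
  simp [BoundaryCondition.lop, twoStepsAntiBounceBack, postVec, Fin.sum_univ_three,
    Finset.sum_range_succ]
  ring

theorem lop_kineticDirichlet (κ ρ U V : ℂ) : kineticDirichlet.lop κ ρ U V = U := by
  simp [BoundaryCondition.lop, kineticDirichlet]

/-- The weights are the coefficients of 1 - (1 - κ)^σ; the factor κ in the second entry of `postVec`
supplies the shift from h to h + 1. -/
theorem lop_extrapolation (σ : ℕ) (κ ρ U V : ℂ) :
    (extrapolation σ).lop κ ρ U V = (1 - κ) ^ σ * U := by
  have h : (1 - κ) ^ σ = 1 - ∑ h ∈ Finset.range σ, ((-1) ^ h * (σ.choose (h + 1) : ℂ)) * κ ^ (h + 1) := by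
    rw [sub_eq_neg_add, add_pow, Finset.sum_range_succ', sub_eq_neg_add, ← Finset.sum_neg_distrib]
    congr 1
    · refine Finset.sum_congr rfl fun n _ => ?_
      rw [neg_pow κ]; ring
    · simp
  rw [h, sub_mul, one_mul, Finset.sum_mul]
  simp only [BoundaryCondition.lop, extrapolation, postVec, Fin.sum_univ_three]
  simp
  refine Finset.sum_congr rfl fun n _ => ?_
  ring

theorem continuous_lop (bc : BoundaryCondition) :
    Continuous fun p : (ℂ × ℂ) × ℂ × ℂ × ℂ => bc.lop p.1.2 p.2.1 p.2.2.1 p.2.2.2 := by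
  have h : ∀ ℓ, Continuous fun p : (ℂ × ℂ) × ℂ × ℂ × ℂ =>
      postVec p.1.2 p.2.1 p.2.2.1 p.2.2.2 ℓ := fun ℓ => by
    fin_cases ℓ <;> simp [postVec] <;> fun_prop
  unfold BoundaryCondition.lop
  fun_prop

theorem lop_smul (bc : BoundaryCondition) (κ ρ U V t : ℂ) :
    bc.lop κ (t * ρ) (t * U) (t * V) = t * bc.lop κ ρ U V := by
  have h : ∀ ℓ, postVec κ (t * ρ) (t * U) (t * V) ℓ = t * postVec κ ρ U V ℓ := fun ℓ => by
    fin_cases ℓ <;> simp [postVec] <;> ring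
  simp only [BoundaryCondition.lop, h, mul_sub, Finset.mul_sum]
  congr 1
  refine Finset.sum_congr rfl fun ℓ _ => Finset.sum_congr rfl fun n _ => ?_
  ring

/-! ### Strong stability -/

/-- The right-hand side is the inverse of the geometric sum over the grid points, so this balances
the prefactor α/(1 + αΔt). -/
theorem div_one_add_le {a : ℝ} (ha : 0 < a) : a / (1 + a) ≤ 1 - Real.exp (-a) ^ 2 := by
  have h1 : 1 + a ≤ Real.exp (2 * a) := by linarith [Real.add_one_le_exp (2 * a)]
  have h2 : Real.exp (-a) ^ 2 = (Real.exp (2 * a))⁻¹ := by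
    rw [← Real.exp_nat_mul, ← Real.exp_neg]; congr 1; push_cast; ring
  have h3 : (Real.exp (2 * a))⁻¹ ≤ (1 + a)⁻¹ := inv_anti₀ (by linarith) h1
  have h4 : a / (1 + a) = 1 - (1 + a)⁻¹ := by field_simp; ring
  rw [h2, h4]; linarith

theorem exp_weight (α Δt : ℝ) (n : ℕ) :
    Real.exp (-2 * α * n * Δt) = (Real.exp (-(α * Δt)) ^ n) ^ 2 := by
  rw [← Real.exp_nat_mul, ← Real.exp_nat_mul]; congr 1; push_cast; ring

theorem norm_modeVec_le {κ ρ U V : ℂ} (hκ : ‖κ‖ ≤ 1) (i : Fin 3) :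
    ‖modeVec κ ρ U V i‖ ≤ 2 * ‖(ρ, U, V)‖ := by
  have h1 : ‖ρ‖ ≤ ‖(ρ, U, V)‖ := norm_fst_le (ρ, U, V)
  have h2 : ‖(U, V)‖ ≤ ‖(ρ, U, V)‖ := norm_snd_le (ρ, U, V)
  have h3 : ‖U‖ ≤ ‖(U, V)‖ := norm_fst_le (U, V)
  have h4 : ‖V‖ ≤ ‖(U, V)‖ := norm_snd_le (U, V)
  have h5 : ‖κ * V‖ ≤ ‖V‖ := by
    rw [norm_mul]; exact mul_le_of_le_one_left (norm_nonneg _) hκ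
  have h6 := norm_nonneg ρ
  fin_cases i <;> simp only [modeVec]
  · exact h1.trans (by linarith)
  · refine (norm_sub_le U (κ * V)).trans ?_; linarith
  · refine (norm_add_le U (κ * V)).trans ?_; linarith

section

variable {a b C s₁ lam : ℝ} {bc : BoundaryCondition}

theorem norm_modeFun_le (h : Admissible a b C) {B : ℝ}
    (hB : ∀ w, ‖w‖ < 1 → ‖((1 : ℂ), nullU a b C w, nullV a b C w)‖
      ≤ B * ‖bc.lop (stableRoot a b C w) 1 (nullU a b C w) (nullV a b C w)‖)
    {w : ℂ} (hw : ‖w‖ < 1) (j : ℕ) (i : Fin 3) :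
    ‖modeFun a b C bc j i w‖ ≤ 2 * B * ‖w‖ ^ j := by
  have hB' := hB w hw
  have hκ := norm_stableRoot_le h hw
  have hm := norm_modeVec_le (ρ := 1) (U := nullU a b C w) (V := nullV a b C w)
    (norm_stableRoot_lt h hw).le i
  set Λ := bc.lop (stableRoot a b C w) 1 (nullU a b C w) (nullV a b C w) with hΛ
  have h1 : (1 : ℝ) ≤ ‖((1 : ℂ), nullU a b C w, nullV a b C w)‖ := by
    simp
  have hΛ0 : 0 < ‖Λ‖ := by
    by_contra hneg
    have : ‖Λ‖ = 0 := le_antisymm (not_lt.1 hneg) (norm_nonneg _)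
    rw [this, mul_zero] at hB'
    linarith
  rw [modeFun, ← hΛ, norm_div, norm_mul, norm_mul, norm_pow, div_le_iff₀ hΛ0]
  calc ‖w‖ * ‖stableRoot a b C w‖ ^ j * ‖modeVec _ 1 (nullU a b C w) (nullV a b C w) i‖
      ≤ 1 * ‖w‖ ^ j * (2 * (B * ‖Λ‖)) := by gcongr; exact hm.trans (by gcongr)
    _ = 2 * B * ‖w‖ ^ j * ‖Λ‖ := by ring

/-- A bound of the eigenvectors by the Lopatinskii functional implies strong stability. -/
theorem stronglyStable_of_bound (h : Admissible a b C) (hlam : 0 < lam) {B : ℝ} (hB0 : 0 < B)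
    (hB : ∀ w, ‖w‖ < 1 → ‖((1 : ℂ), nullU a b C w, nullV a b C w)‖
      ≤ B * ‖bc.lop (stableRoot a b C w) 1 (nullU a b C w) (nullV a b C w)‖) :
    StronglyStable lam C ![s₁, 1 - a, 1 - b] bc := by
  have hlop : ∀ w, ‖w‖ < 1 →
      bc.lop (stableRoot a b C w) 1 (nullU a b C w) (nullV a b C w) ≠ 0 := fun w hw h0 => by
    have := hB w hw
    rw [h0, norm_zero, mul_zero] at this
    simpa using norm_le_zero_iff.1 this
  obtain ⟨c, hc, hm⟩ := exists_moments_eq_conv (s₁ := s₁) h bc hlop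
  -- Three moments, each contributing (2B)², and Δx = lam Δt.
  refine ⟨12 * B ^ 2 * lam, by positivity, fun α hα Δx hΔx Δt hΔt g => ?_⟩
  have hΔt0 : 0 < Δt := hΔt ▸ div_pos hΔx hlam
  have hΔ : Δx = lam * Δt := by rw [hΔt]; field_simp
  set r := Real.exp (-(α * Δt)) with hr
  have hr0 : 0 < r := Real.exp_pos _
  have hαt : 0 < α * Δt := by positivity
  have hr1 : r < 1 := Real.exp_lt_one_iff.2 (by linarith)
  have hr2 : r ^ 2 < 1 := by nlinarith
  set m := moments C ![s₁, 1 - a, 1 - b] bc g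
  set S := ∑' n : ℕ, ENNReal.ofReal (Δt * Real.exp (-2 * α * n * Δt) * g n ^ 2) with hS
  have hpart : ∀ j N, ∑ n ∈ Finset.range N, Δt * Δx * Real.exp (-2 * α * n * Δt) *
      ∑ i, m n j i ^ 2 ≤ 12 * B ^ 2 * Δx * (r ^ 2) ^ j *
        ∑ n ∈ Finset.range N, Δt * Real.exp (-2 * α * n * Δt) * g n ^ 2 := by
    intro j N
    have hi : ∀ i, ∑ n ∈ Finset.range N, (r ^ n) ^ 2 * m n j i ^ 2
        ≤ (2 * B * r ^ j) ^ 2 * ∑ n ∈ Finset.range N, (r ^ n) ^ 2 * g n ^ 2 := by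
      intro i
      have := sum_conv_le (hc j i) hr0.le hr1 (B := 2 * B * r ^ j)
        (fun w hw => hw ▸ norm_modeFun_le h hB (hw ▸ hr1) j i) (fun n => g n) N
      simpa only [← hm, Complex.norm_real, mul_pow, Real.norm_eq_abs, sq_abs] using this
    calc ∑ n ∈ Finset.range N, Δt * Δx * Real.exp (-2 * α * n * Δt) * ∑ i, m n j i ^ 2
        = Δt * Δx * ∑ i, ∑ n ∈ Finset.range N, (r ^ n) ^ 2 * m n j i ^ 2 := by
          rw [Finset.sum_comm, Finset.mul_sum]
          refine Finset.sum_congr rfl fun n _ => ?_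
          rw [exp_weight, ← Finset.mul_sum]; ring
      _ ≤ Δt * Δx * ∑ _i : Fin 3, (2 * B * r ^ j) ^ 2 *
            ∑ n ∈ Finset.range N, (r ^ n) ^ 2 * g n ^ 2 := by gcongr with i; exact hi i
      _ = 12 * B ^ 2 * Δx * (r ^ 2) ^ j *
            ∑ n ∈ Finset.range N, Δt * Real.exp (-2 * α * n * Δt) * g n ^ 2 := by
          have : ∑ n ∈ Finset.range N, Δt * Real.exp (-2 * α * n * Δt) * g n ^ 2
              = Δt * ∑ n ∈ Finset.range N, (r ^ n) ^ 2 * g n ^ 2 := by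
            rw [Finset.mul_sum]
            refine Finset.sum_congr rfl fun n _ => ?_
            rw [exp_weight]; ring
          rw [this]
          simp only [Finset.sum_const, Finset.card_univ, Fintype.card_fin, nsmul_eq_mul]
          push_cast; ring
  have hj : ∀ j, ∑' n : ℕ, ENNReal.ofReal (Δt * Δx * Real.exp (-2 * α * n * Δt) *
      ∑ i, m n j i ^ 2) ≤ ENNReal.ofReal (12 * B ^ 2 * Δx * (r ^ 2) ^ j) * S := by
    intro j
    refine ENNReal.tsum_le_of_sum_range_le fun N => ?_
    rw [← ENNReal.ofReal_sum_of_nonneg fun n _ => by positivity]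
    refine (ENNReal.ofReal_le_ofReal (hpart j N)).trans ?_
    rw [ENNReal.ofReal_mul (by positivity), ENNReal.ofReal_sum_of_nonneg fun n _ => by positivity]
    gcongr
    exact ENNReal.sum_le_tsum _
  have hgeom : ∑' j : ℕ, ENNReal.ofReal (12 * B ^ 2 * Δx * (r ^ 2) ^ j)
      = ENNReal.ofReal (12 * B ^ 2 * Δx * (1 - r ^ 2)⁻¹) := by
    rw [← ENNReal.ofReal_tsum_of_nonneg (fun j => by positivity)
      ((summable_geometric_of_lt_one (sq_nonneg r) hr2).mul_left _), tsum_mul_left,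
      tsum_geometric_of_lt_one (sq_nonneg r) hr2]
  rw [ENNReal.tsum_comm]
  calc ENNReal.ofReal (α / (1 + α * Δt)) * ∑' j : ℕ, ∑' n : ℕ, ENNReal.ofReal
        (Δt * Δx * Real.exp (-2 * α * n * Δt) * ∑ i, m n j i ^ 2)
      ≤ ENNReal.ofReal (α / (1 + α * Δt)) *
          ∑' j : ℕ, ENNReal.ofReal (12 * B ^ 2 * Δx * (r ^ 2) ^ j) * S := by
        gcongr with j; exact hj j
    _ = ENNReal.ofReal (α / (1 + α * Δt) * (12 * B ^ 2 * Δx * (1 - r ^ 2)⁻¹)) * S := by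
        rw [ENNReal.tsum_mul_right, hgeom, ← mul_assoc, ← ENNReal.ofReal_mul (by positivity)]
    _ ≤ ENNReal.ofReal (12 * B ^ 2 * lam) * S := by
        refine mul_le_mul_left (ENNReal.ofReal_le_ofReal ?_) S
        have h1 := div_one_add_le hαt
        have h2 : 0 < 1 - r ^ 2 := by linarith
        have h3 : α * Δt / (1 + α * Δt) * (1 - r ^ 2)⁻¹ ≤ 1 := by
          rw [← div_eq_mul_inv, div_le_one h2]; exact h1
        calc α / (1 + α * Δt) * (12 * B ^ 2 * Δx * (1 - r ^ 2)⁻¹)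
            = 12 * B ^ 2 * lam * (α * Δt / (1 + α * Δt) * (1 - r ^ 2)⁻¹) := by rw [hΔ]; ring
          _ ≤ 12 * B ^ 2 * lam * 1 := by gcongr
          _ = 12 * B ^ 2 * lam := mul_one _

theorem stronglyStable_of_ne_zero (h : Admissible a b C) (hlam : 0 < lam)
    (h0 : ∀ w κ ρ U V, (w, κ) ∈ stableGraph a b C → IsNull a b C w κ ρ U V → (ρ, U, V) ≠ 0 →
      bc.lop κ ρ U V ≠ 0) :
    StronglyStable lam C ![s₁, 1 - a, 1 - b] bc := by
  obtain ⟨B, hB0, hB⟩ := exists_bound_of_ne_zero (continuous_lop bc) (lop_smul bc) h0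
  exact stronglyStable_of_bound h hlam hB0 fun w hw =>
    hB _ _ _ _ _ (mem_stableGraph h hw) (isNull_stableRoot h hw)

theorem stronglyStable_antiBounceBack (h : Admissible a b C) (hlam : 0 < lam) :
    StronglyStable lam C ![s₁, 1 - a, 1 - b] antiBounceBack :=
  stronglyStable_of_ne_zero h hlam fun w κ ρ U V hm hn hne => by
    rw [lop_antiBounceBack]
    exact hn.add_ne_zero h hm.1 hne

theorem stronglyStable_twoStepsAntiBounceBack (h : Admissible a b C) (hlam : 0 < lam) :
    StronglyStable lam C ![s₁, 1 - a, 1 - b] twoStepsAntiBounceBack :=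
  stronglyStable_of_ne_zero h hlam fun w κ ρ U V hm hn hne => by
    rw [lop_twoStepsAntiBounceBack]
    exact hn.rho_ne_zero h hm.1 hne

theorem stronglyStable_kineticDirichlet (h : Admissible a b C) (hlam : 0 < lam) :
    StronglyStable lam C ![s₁, 1 - a, 1 - b] kineticDirichlet :=
  stronglyStable_of_ne_zero h hlam fun w κ ρ U V hm hn hne => by
    rw [lop_kineticDirichlet]
    exact hn.U_ne_zero h hm.1 hm.2.1 hne

theorem stronglyStable_bounceBack (h : Admissible a b C) (hlam : 0 < lam) (hC : 0 < C) :
    StronglyStable lam C ![s₁, 1 - a, 1 - b] bounceBack :=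
  stronglyStable_of_ne_zero h hlam fun w κ ρ U V hm hn hne => by
    rw [lop_bounceBack]
    exact hn.sub_ne_zero h hC hm.1 hm.2.1 hne

theorem stronglyStable_extrapolation (h : Admissible a b C) (hlam : 0 < lam) (hC : C < 0) (σ : ℕ) :
    StronglyStable lam C ![s₁, 1 - a, 1 - b] (extrapolation σ) :=
  stronglyStable_of_ne_zero h hlam fun w κ ρ U V hm hn hne => by
    rw [lop_extrapolation]
    exact mul_ne_zero (pow_ne_zero _ (sub_ne_zero.2 (kappa_ne_one_of_mem h hC hm).symm))
      (hn.U_ne_zero h hm.1 hm.2.1 hne)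

end

/-! ### Instability -/

theorem StronglyStable.observed {lam C : ℝ} {s : Fin 3 → ℝ} {bc : BoundaryCondition}
    (hlam : 0 < lam) (h : StronglyStable lam C s bc) : StronglyStableObserved lam C s bc := by
  obtain ⟨K, hK, hest⟩ := h
  refine ⟨K, hK, fun α hα Δx hΔx Δt hΔt g => (le_trans ?_ (hest α hα Δx hΔx Δt hΔt g))⟩
  have hΔt0 : 0 < Δt := hΔt ▸ div_pos hΔx hlam
  gcongr with n j
  exact Finset.single_le_sum (f := fun i => moments C s bc g n j i ^ 2) (fun i _ => sq_nonneg _)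
    (Finset.mem_univ 0)

theorem hasTaylor_one : HasTaylor (fun _ => 1) fun w => (1 - w)⁻¹ := fun w hw => by
  simpa using hasSum_geometric_of_norm_lt_one hw

section

variable {a b C s₁ lam : ℝ} {bc : BoundaryCondition}

/-- The stability estimate for the observed output, at `x₀`, with the source `1, 1, 1, …`. -/
theorem StronglyStableObserved.exists_norm_modeFun_le (h : Admissible a b C) (hlam : 0 < lam)
    (h0 : ∀ w, ‖w‖ < 1 → bc.lop (stableRoot a b C w) 1 (nullU a b C w) (nullV a b C w) ≠ 0)
    (hst : StronglyStableObserved lam C ![s₁, 1 - a, 1 - b] bc) :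
    ∃ K : ℝ, 0 < K ∧ ∀ α : ℝ, 0 < α →
      ‖modeFun a b C bc 0 0 ((Real.exp (-α) ^ 2 : ℝ) : ℂ)‖ ^ 2 * α ≤ K * (1 + α) := by
  obtain ⟨K, hK, hest⟩ := hst
  obtain ⟨c, hc, hm⟩ := exists_moments_eq_conv (s₁ := s₁) h bc h0
  refine ⟨K / lam, by positivity, fun α hα => ?_⟩
  set r := Real.exp (-α) with hr
  have hr0 : 0 < r := Real.exp_pos _
  have hr1 : r < 1 := Real.exp_lt_one_iff.2 (by linarith)
  have hr2 : r ^ 2 < 1 := by nlinarith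
  have hr3 : 0 < 1 - r ^ 2 := by linarith
  have hexp : ∀ n : ℕ, Real.exp (-2 * α * n) = (r ^ n) ^ 2 := fun n => by
    simpa using exp_weight α 1 n
  set y : ℕ → ℝ := fun n => moments C ![s₁, 1 - a, 1 - b] bc (fun _ => 1) n 0 0 with hy
  have hgeo : ∀ N, ∑ n ∈ Finset.range N, (r ^ n) ^ 2 ≤ (1 - r ^ 2)⁻¹ := fun N => by
    rw [← tsum_geometric_of_lt_one (sq_nonneg r) hr2]
    have hs := summable_geometric_of_lt_one (sq_nonneg r) hr2
    refine le_trans (le_of_eq ?_) (hs.sum_le_tsum (Finset.range N) fun n _ => by positivity)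
    exact Finset.sum_congr rfl fun n _ => by ring
  have hN : ∀ N, ∑ n ∈ Finset.range N, (r ^ n) ^ 2 * y n ^ 2
      ≤ K / lam * (1 + α) / α * (1 - r ^ 2)⁻¹ := by
    intro N
    -- The choice Δx = lam makes Δt = 1.
    have h1 := hest α hα lam hlam 1 (by field_simp) (fun _ => 1)
    simp only [hexp, one_mul, one_pow, mul_one] at h1
    have h2 : ∑' n : ℕ, ENNReal.ofReal ((r ^ n) ^ 2) = ENNReal.ofReal ((1 - r ^ 2)⁻¹) := by
      rw [← tsum_geometric_of_lt_one (sq_nonneg r) hr2,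
        ENNReal.ofReal_tsum_of_nonneg (fun n => by positivity)
          (summable_geometric_of_lt_one (sq_nonneg r) hr2)]
      exact tsum_congr fun n => by ring_nf
    rw [h2, ← ENNReal.ofReal_mul hK.le] at h1
    have h3 : ENNReal.ofReal (∑ n ∈ Finset.range N, lam * (r ^ n) ^ 2 * y n ^ 2)
        ≤ ∑' n : ℕ, ∑' j : ℕ, ENNReal.ofReal (lam * (r ^ n) ^ 2 *
          moments C ![s₁, 1 - a, 1 - b] bc (fun _ => 1) n j 0 ^ 2) := by
      rw [ENNReal.ofReal_sum_of_nonneg fun n _ => by positivity]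
      refine (Finset.sum_le_sum fun n _ => ?_).trans (ENNReal.sum_le_tsum (Finset.range N))
      exact ENNReal.le_tsum 0
    have h4 : ENNReal.ofReal (α / (1 + α) * ∑ n ∈ Finset.range N, lam * (r ^ n) ^ 2 * y n ^ 2)
        ≤ ENNReal.ofReal (K * (1 - r ^ 2)⁻¹) := by
      rw [ENNReal.ofReal_mul (by positivity)]
      exact (mul_le_mul_right h3 _).trans h1
    rw [ENNReal.ofReal_le_ofReal_iff (by positivity)] at h4
    have h5 : ∑ n ∈ Finset.range N, lam * (r ^ n) ^ 2 * y n ^ 2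
        = lam * ∑ n ∈ Finset.range N, (r ^ n) ^ 2 * y n ^ 2 := by
      rw [Finset.mul_sum]; exact Finset.sum_congr rfl fun n _ => by ring
    rw [h5] at h4
    rw [show K / lam * (1 + α) / α * (1 - r ^ 2)⁻¹
      = (K * (1 - r ^ 2)⁻¹) / (α / (1 + α) * lam) by field_simp, le_div_iff₀ (by positivity)]
    linarith
  set x : ℂ := ((r ^ 2 : ℝ) : ℂ) with hx
  have hx1 : ‖x‖ < 1 := by rw [hx, Complex.norm_real, Real.norm_of_nonneg (sq_nonneg r)]; exact hr2
  have hsum : HasSum (fun n => (y n : ℂ) * x ^ n) (modeFun a b C bc 0 0 x * (1 - x)⁻¹) := by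
    have := ((hc 0 0).conv hasTaylor_one) x hx1
    convert this using 2 with n
    rw [hy]
    simp only [hm]
    simp
  -- Since x = r², the terms split as (r^n y n) r^n, and Cauchy-Schwarz applies; the two factors (1
  -- - r²)⁻¹ later cancel against |1 - x|⁻².
  have hlim : ‖modeFun a b C bc 0 0 x * (1 - x)⁻¹‖ ^ 2
      ≤ K / lam * (1 + α) / α * (1 - r ^ 2)⁻¹ * (1 - r ^ 2)⁻¹ := by
    refine le_of_tendsto ((hsum.tendsto_sum_nat.norm).pow 2) (Eventually.of_forall fun N => ?_)
    have e : ∑ n ∈ Finset.range N, (y n : ℂ) * x ^ n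
        = ((∑ n ∈ Finset.range N, (r ^ n * y n) * r ^ n : ℝ) : ℂ) := by
      rw [Complex.ofReal_sum]
      refine Finset.sum_congr rfl fun n _ => ?_
      rw [hx]; push_cast; ring
    rw [e, Complex.norm_real, Real.norm_eq_abs, sq_abs]
    refine (Finset.sum_mul_sq_le_sq_mul_sq _ _ _).trans ?_
    simp only [mul_pow (r ^ _)]
    exact mul_le_mul (hN N) (hgeo N) (Finset.sum_nonneg fun n _ => by positivity) (by positivity)
  have hx2 : ‖(1 - x)⁻¹‖ = (1 - r ^ 2)⁻¹ := by
    rw [hx, norm_inv, ← Complex.ofReal_one, ← Complex.ofReal_sub, Complex.norm_real,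
      Real.norm_of_nonneg hr3.le]
  rw [norm_mul, hx2, mul_pow, pow_two (1 - r ^ 2)⁻¹, ← mul_assoc] at hlim
  have hpos : 0 < (1 - r ^ 2)⁻¹ := inv_pos.2 hr3
  have h6 := le_of_mul_le_mul_right (le_of_mul_le_mul_right hlim hpos) hpos
  rwa [le_div_iff₀ hα] at h6

/-- If the Lopatinskii functional vanishes at `z = 1` then the scheme is not strongly stable. -/
theorem not_stronglyStableObserved (h : Admissible a b C) (hlam : 0 < lam)
    (h0 : ∀ w, ‖w‖ < 1 → bc.lop (stableRoot a b C w) 1 (nullU a b C w) (nullV a b C w) ≠ 0)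
    {M : ℝ} (hM0 : 0 < M) (hM : ∀ w, ‖w‖ < 1 →
      ‖bc.lop (stableRoot a b C w) 1 (nullU a b C w) (nullV a b C w)‖ ≤ M * ‖1 - w‖) :
    ¬ StronglyStableObserved lam C ![s₁, 1 - a, 1 - b] bc := by
  intro hst
  obtain ⟨K, hK, hest⟩ := hst.exists_norm_modeFun_le h hlam h0
  -- The bound 1/4 ensures x ≥ 1/2 and 1 + α ≤ 2; the other makes 8M²Kα ≤ 1/8, below the lower bound
  -- (1/2)² of `h7`.
  set α : ℝ := min (1 / 4) (1 / (64 * M ^ 2 * K)) with hα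
  have hα0 : 0 < α := by positivity
  have hα1 : α ≤ 1 / 4 := min_le_left _ _
  have hα2 : α * (64 * M ^ 2 * K) ≤ 1 := by
    rw [← le_div_iff₀ (by positivity)]; exact min_le_right _ _
  have h1 := hest α hα0
  obtain ⟨x, hx⟩ : ∃ x, x = Real.exp (-α) ^ 2 := ⟨_, rfl⟩
  rw [← hx] at h1
  have hx0 : 1 - 2 * α ≤ x := by
    rw [hx, ← Real.exp_nat_mul]
    have := Real.add_one_le_exp (((2 : ℕ) : ℝ) * -α)
    push_cast at this ⊢; linarith
  have hx1 : x < 1 := by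
    rw [hx, ← Real.exp_nat_mul]; exact Real.exp_lt_one_iff.2 (by push_cast; linarith)
  have hxn : ‖(x : ℂ)‖ = x := by rw [Complex.norm_real, Real.norm_of_nonneg (by linarith)]
  have h2 := hM x (by rw [hxn]; exact hx1)
  have h3 := norm_pos_iff.2 (h0 x (by rw [hxn]; exact hx1))
  rw [← Complex.ofReal_one, ← Complex.ofReal_sub, Complex.norm_real,
    Real.norm_of_nonneg (by linarith), Complex.ofReal_one] at h2
  set Λ := bc.lop (stableRoot a b C x) 1 (nullU a b C x) (nullV a b C x) with hΛ
  have h4 : ‖modeFun a b C bc 0 0 (x : ℂ)‖ * ‖Λ‖ = x := by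
    rw [modeFun, ← hΛ, norm_div, div_mul_cancel₀ _ h3.ne']
    simp only [modeVec, pow_zero, mul_one, norm_mul, hxn]
    simp
  set H := ‖modeFun a b C bc 0 0 (x : ℂ)‖ with hH
  have hH0 : 0 ≤ H := norm_nonneg _
  have h5 : ‖Λ‖ ≤ 2 * M * α := h2.trans (by nlinarith)
  have h6 : 1 / 2 ≤ H * (2 * M * α) := by
    have : H * ‖Λ‖ ≤ H * (2 * M * α) := by gcongr
    linarith
  have h7 : (1 / 2) ^ 2 ≤ (H * (2 * M * α)) ^ 2 := by gcongr
  have h8 : (H * (2 * M * α)) ^ 2 = 4 * M ^ 2 * α * (H ^ 2 * α) := by ring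
  have h9 : 4 * M ^ 2 * α * (H ^ 2 * α) ≤ 4 * M ^ 2 * α * (K * (1 + α)) := by gcongr
  have h10 : 4 * M ^ 2 * α * (K * (1 + α)) ≤ 4 * M ^ 2 * α * (K * 2) := by gcongr; linarith
  linarith

/-- By mass balance the functional is (1 - w)/(1 - κ), and for outflow κ stays away from 1. -/
theorem not_stronglyStableObserved_bounceBack (h : Admissible a b C) (hlam : 0 < lam)
    (hC : C < 0) : ¬ StronglyStableObserved lam C ![s₁, 1 - a, 1 - b] bounceBack := by
  obtain ⟨B, hB0, hB⟩ := exists_bound_of_ne_zero (a := a) (b := b) (C := C)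
    (L := fun κ ρ _ _ => (1 - κ) * ρ) (by fun_prop) (fun κ ρ U V t => by ring)
    fun w κ ρ U V hm hn hne => mul_ne_zero (sub_ne_zero.2 (kappa_ne_one_of_mem h hC hm).symm)
      (hn.rho_ne_zero h hm.1 hne)
  have hlop : ∀ w, bounceBack.lop (stableRoot a b C w) 1 (nullU a b C w) (nullV a b C w)
      = (1 - w) / (1 - stableRoot a b C w) := fun w => by
    rw [lop_bounceBack, nullV, massRatio]; ring
  refine not_stronglyStableObserved h hlam (fun w hw => ?_) hB0 fun w hw => ?_
  · rw [hlop]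
    exact div_ne_zero (one_sub_ne_zero_of_norm_lt hw)
      (one_sub_ne_zero_of_norm_lt (norm_stableRoot_lt h hw))
  · have h1 := hB _ _ _ _ _ (mem_stableGraph h hw) (isNull_stableRoot h hw)
    have h2 := (norm_fst_le ((1 : ℂ), nullU a b C w, nullV a b C w)).trans h1
    have h3 := norm_pos_iff.2 (one_sub_ne_zero_of_norm_lt (norm_stableRoot_lt h hw))
    rw [mul_one, norm_one] at h2
    rw [hlop, norm_div, div_le_iff₀ h3]
    nlinarith [norm_nonneg (1 - w)]

/-- For inflow U - V is bounded below, so mass balance gives |1 - κ| ≤ B'|1 - w|. One such factor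
suffices; the other σ - 1 are bounded by 2. -/
theorem not_stronglyStableObserved_extrapolation (h : Admissible a b C) (hlam : 0 < lam)
    (hC : 0 < C) {σ : ℕ} (hσ : 1 ≤ σ) :
    ¬ StronglyStableObserved lam C ![s₁, 1 - a, 1 - b] (extrapolation σ) := by
  obtain ⟨B, hB0, hB⟩ := exists_bound_of_ne_zero (a := a) (b := b) (C := C)
    (L := fun _ ρ _ _ => ρ) (by fun_prop) (fun κ ρ U V t => by ring)
    fun w κ ρ U V hm hn hne => hn.rho_ne_zero h hm.1 hne
  obtain ⟨B', hB0', hB'⟩ := exists_bound_of_ne_zero (a := a) (b := b) (C := C)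
    (L := fun _ _ U V => U - V) (by fun_prop) (fun κ ρ U V t => by ring)
    fun w κ ρ U V hm hn hne => hn.sub_ne_zero h hC hm.1 hm.2.1 hne
  refine not_stronglyStableObserved h hlam (M := 2 ^ (σ - 1) * B' * B) (fun w hw => ?_)
    (by positivity) fun w hw => ?_
  · rw [lop_extrapolation]
    exact mul_ne_zero (pow_ne_zero _ (one_sub_ne_zero_of_norm_lt (norm_stableRoot_lt h hw)))
      ((isNull_stableRoot h hw).U_ne_zero h hw.le (norm_stableRoot_lt h hw).le (by simp))
  · have hm := mem_stableGraph h hw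
    have hn := isNull_stableRoot h hw
    have h1 := (norm_fst_le ((1 : ℂ), nullU a b C w, nullV a b C w)).trans (hB' _ _ _ _ _ hm hn)
    have h2 := ((norm_fst_le (nullU a b C w, nullV a b C w)).trans
      (norm_snd_le ((1 : ℂ), nullU a b C w, nullV a b C w))).trans (hB _ _ _ _ _ hm hn)
    have h3 := congrArg norm hn.mass
    rw [norm_mul, norm_mul, norm_one, mul_one] at h3
    simp only [norm_one, mul_one] at h1 h2
    have h4 : ‖1 - stableRoot a b C w‖ ≤ B' * ‖1 - w‖ := by
      rw [h3]; nlinarith [norm_nonneg (1 - stableRoot a b C w)]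
    have h5 : ‖1 - stableRoot a b C w‖ ≤ 2 := by
      refine (norm_sub_le _ _).trans ?_
      rw [norm_one]; linarith [norm_stableRoot_lt h hw]
    rw [lop_extrapolation, norm_mul, norm_pow, ← Nat.sub_add_cancel hσ, pow_succ,
      Nat.add_sub_cancel]
    calc ‖1 - stableRoot a b C w‖ ^ (σ - 1) * ‖1 - stableRoot a b C w‖ * ‖nullU a b C w‖
        ≤ 2 ^ (σ - 1) * (B' * ‖1 - w‖) * B := by gcongr
      _ = 2 ^ (σ - 1) * B' * B * ‖1 - w‖ := by ring

end

/-! ### Critical pairs -/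

section

variable {a b C s₁ lam : ℝ} {bc : BoundaryCondition} {z κ ρ U V : ℂ}

theorem characteristic_eq_charPoly (hz : z ≠ 0) :
    characteristic C ![s₁, 1 - a, 1 - b] z κ = -(z ^ 3 / 2) * charPoly a b C z⁻¹ κ := by
  rw [characteristic, postRelaxation_eq, momentMatrix, Matrix.mul_fin_three, det_fin_three]
  simp [toComplex, Matrix.mul_apply, diagonal, charPoly]
  field_simp
  ring

theorem isStableRoot_iff (h : Admissible a b C) (hz : 1 < ‖z‖) :
    IsStableRoot C ![s₁, 1 - a, 1 - b] z κ ↔ κ = stableRoot a b C z⁻¹ := by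
  have hz0 : z ≠ 0 := norm_pos_iff.1 (by linarith)
  have hw : ‖z⁻¹‖ < 1 := by rw [norm_inv]; exact inv_lt_one_of_one_lt₀ hz
  rw [IsStableRoot, characteristic_eq_charPoly hz0]
  constructor
  · rintro ⟨h1, h2⟩
    exact eq_stableRoot h hw h1 ((mul_eq_zero.1 h2).resolve_left (by simpa using hz0))
  · rintro rfl
    exact ⟨norm_stableRoot_lt h hw, by rw [charPoly_stableRoot h hw, mul_zero]⟩

theorem stableRootTendsto_one (h : Admissible a b C)
    (hu : ∀ κ', (1, κ') ∈ stableGraph a b C → κ' = κ) :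
    StableRootTendsto C ![s₁, 1 - a, 1 - b] 1 κ := by
  refine ⟨fun z => stableRoot a b C z⁻¹, ?_, ?_⟩
  · filter_upwards [self_mem_nhdsWithin] with z hz κ using isStableRoot_iff h hz
  · refine (tendsto_stableRoot h hu).comp (tendsto_nhdsWithin_iff.2 ⟨?_, ?_⟩)
    · have : Tendsto (fun z : ℂ => z⁻¹) (𝓝 1) (𝓝 1⁻¹) := (continuousAt_inv₀ one_ne_zero).tendsto
      rw [inv_one] at this
      exact this.mono_left nhdsWithin_le_nhds
    · filter_upwards [self_mem_nhdsWithin] with z hz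
      rw [mem_ball_zero_iff, norm_inv]
      exact inv_lt_one_of_one_lt₀ hz

theorem toComplex_momentMatrix_mulVec (v : Fin 3 → ℂ) :
    toComplex momentMatrix *ᵥ v = ![v 0 + v 1 + v 2, v 1 - v 2, v 1 + v 2] := by
  ext i
  fin_cases i <;> simp [toComplex, momentMatrix, mulVec, dotProduct, Fin.sum_univ_three]
  ring

theorem bulkPencil_mulVec (s φ : _) : (bulkPencil C s z κ) *ᵥ φ = (z * κ) • φ -
    toComplex momentMatrix *ᵥ ![κ * (toComplex (postRelaxation C s) *ᵥ φ) 0,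
      (toComplex (postRelaxation C s) *ᵥ φ) 1,
      κ ^ 2 * (toComplex (postRelaxation C s) *ᵥ φ) 2] := by
  rw [bulkPencil, sub_mulVec, smul_mulVec, one_mulVec, ← mulVec_mulVec, ← mulVec_mulVec]
  congr 2
  ext i
  rw [mulVec_diagonal]
  fin_cases i <;> simp [velocity]

theorem boundarySymbol_mulVec (s φ : _) : (z • 1 - boundarySymbol C s bc κ) *ᵥ φ = z • φ -
    toComplex momentMatrix *ᵥ ![(toComplex (postRelaxation C s) *ᵥ φ) 0,
      ∑ ℓ, ∑ h ∈ Finset.range bc.width,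
        (bc.weight ℓ h : ℂ) * (κ ^ h * (toComplex (postRelaxation C s) *ᵥ φ) ℓ),
      κ * (toComplex (postRelaxation C s) *ᵥ φ) 2] := by
  rw [boundarySymbol, sub_mulVec, smul_mulVec, one_mulVec, ← mulVec_mulVec, ← mulVec_mulVec]
  congr 2
  ext i
  generalize toComplex (postRelaxation C s) *ᵥ φ = u
  fin_cases i
  · simp [mulVec, dotProduct, velocity]
  · simp [mulVec, dotProduct, velocity, Finset.sum_mul, mul_assoc]
  · simp [mulVec, dotProduct, velocity]

theorem isNull_of_postRelaxation_modeVec {w : ℂ}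
    (hp : toComplex (postRelaxation C ![s₁, 1 - a, 1 - b]) *ᵥ (w • modeVec κ ρ U V)
      = postVec κ ρ U V) : IsNull a b C w κ ρ U V := by
  have h0 := congrFun hp 0
  have h1 := congrFun hp 1
  have h2 := congrFun hp 2
  rw [postRelaxation_eq] at h0 h1 h2
  simp [toComplex, mulVec, dotProduct, Fin.sum_univ_three, modeVec, postVec] at h0 h1 h2
  refine ⟨?_, ?_, ?_⟩
  · linear_combination -h0 - h1 - h2
  · linear_combination -h1 + h2
  · linear_combination -h1 - h2

theorem IsNull.toComplex_mulVec {w : ℂ} (hn : IsNull a b C w κ ρ U V) :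
    toComplex (postRelaxation C ![s₁, 1 - a, 1 - b]) *ᵥ (w • modeVec κ ρ U V)
      = postVec κ ρ U V := by
  ext k
  rw [← hn.postRelaxation_modeVec (s₁ := s₁) k]
  simp [toComplex, mulVec, dotProduct]

/-- A shared eigenvector provides a bulk mode on which the Lopatinskii functional vanishes. -/
theorem exists_isNull_of_isCritical (hz : z ≠ 0)
    (hc : IsCritical C ![s₁, 1 - a, 1 - b] bc z κ) :
    ∃ ρ U V, (ρ, U, V) ≠ 0 ∧ IsNull a b C z⁻¹ κ ρ U V ∧ bc.lop κ ρ U V = 0 := by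
  obtain ⟨-, φ, hφ, h1, h2⟩ := hc
  rw [bulkPencil_mulVec, toComplex_momentMatrix_mulVec] at h1
  rw [boundarySymbol_mulVec, toComplex_momentMatrix_mulVec] at h2
  set u := toComplex (postRelaxation C ![s₁, 1 - a, 1 - b]) *ᵥ φ with hu
  set G := ∑ ℓ, ∑ h ∈ Finset.range bc.width, (bc.weight ℓ h : ℂ) * (κ ^ h * u ℓ) with hG
  have b0 := congrFun h1 0
  have b1 := congrFun h1 1
  have b2 := congrFun h1 2
  have c0 := congrFun h2 0
  have c1 := congrFun h2 1
  have c2 := congrFun h2 2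
  simp at b0 b1 b2 c0 c1 c2
  -- The boundary equations express φ through ρ = z φ₀, the prescribed ghost value G and V = u₂.
  have hφv : φ = z⁻¹ • modeVec κ (z * φ 0) G (u 2) := by
    ext i
    fin_cases i <;> simp [modeVec]
    · field_simp
    · field_simp; linear_combination c1
    · field_simp; linear_combination c2
  have hpost : u = postVec κ (z * φ 0) G (u 2) := by
    ext i
    fin_cases i <;> simp [postVec]
    · linear_combination -c0
    -- Bulk and boundary equations differ only in the incoming distribution function, so their
    -- comparison gives u₁ = κ G.
    · linear_combination (κ * (c1 + c2) - b1 - b2) / 2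
  refine ⟨z * φ 0, G, u 2, fun h0 => hφ ?_, isNull_of_postRelaxation_modeVec (s₁ := s₁) ?_, ?_⟩
  · simp only [Prod.mk_eq_zero] at h0
    rw [hφv, h0.1, h0.2.1, h0.2.2]
    ext i
    fin_cases i <;> simp [modeVec]
  · rw [← hφv, ← hpost]
  · rw [BoundaryCondition.lop, ← hpost, ← hG, sub_self]

theorem IsNull.isCritical (hn : IsNull a b C z⁻¹ κ ρ U V) (hz : z ≠ 0) (hρ : ρ ≠ 0)
    (hl : bc.lop κ ρ U V = 0) (hzκ : 1 < ‖z‖ ∧ ‖κ‖ < 1 ∨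
      ‖z‖ = 1 ∧ ‖κ‖ ≤ 1 ∧ StableRootTendsto C ![s₁, 1 - a, 1 - b] z κ) :
    IsCritical C ![s₁, 1 - a, 1 - b] bc z κ := by
  have hφ : z⁻¹ • modeVec κ ρ U V ≠ 0 := fun h0 => by
    have := congrFun h0 0
    simp [modeVec, hz, hρ] at this
  have hU : U = ∑ ℓ, ∑ h ∈ Finset.range bc.width,
      (bc.weight ℓ h : ℂ) * (κ ^ h * postVec κ ρ U V ℓ) := by
    rwa [BoundaryCondition.lop, sub_eq_zero] at hl
  have h1 : bulkPencil C ![s₁, 1 - a, 1 - b] z κ *ᵥ (z⁻¹ • modeVec κ ρ U V) = 0 := by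
    rw [bulkPencil_mulVec, toComplex_momentMatrix_mulVec, hn.toComplex_mulVec]
    ext i
    fin_cases i <;> simp [modeVec, postVec] <;> field_simp <;> ring
  have h2 : (z • 1 - boundarySymbol C ![s₁, 1 - a, 1 - b] bc κ) *ᵥ
      (z⁻¹ • modeVec κ ρ U V) = 0 := by
    rw [boundarySymbol_mulVec, toComplex_momentMatrix_mulVec, hn.toComplex_mulVec, ← hU]
    ext i
    fin_cases i <;> simp [modeVec, postVec] <;> field_simp <;> ring
  exact ⟨⟨hzκ, exists_mulVec_eq_zero_iff.1 ⟨_, hφ, h1⟩, exists_mulVec_eq_zero_iff.1 ⟨_, hφ, h2⟩⟩,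
    _, hφ, h1, h2⟩

theorem IsCritical.norm_le {s : Fin 3 → ℝ} (hc : IsCritical C s bc z κ) :
    1 ≤ ‖z‖ ∧ ‖κ‖ ≤ 1 := by
  rcases hc.1.1 with h | h
  exacts [⟨h.1.le, h.2.le⟩, ⟨h.1.ge, h.2.1⟩]

theorem mildlyUnstableLocalized_bounceBack (h : Admissible a b C) (hlam : 0 < lam) (hC : C < 0) :
    MildlyUnstableLocalized lam C ![s₁, 1 - a, 1 - b] bounceBack := by
  have hno := not_stronglyStableObserved_bounceBack (s₁ := s₁) h hlam hC
  refine ⟨fun hs => hno (hs.observed hlam), hno, ⟨1, otherRoot a C, ?_⟩, fun z κ hc => ?_⟩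
  · have hr := abs_otherRoot_lt h hC
    have hρ : (1 : ℂ) + otherRoot a C ≠ 0 :=
      one_add_ne_zero_of_norm_lt (by simpa using hr)
    refine IsNull.isCritical (ρ := 1 + otherRoot a C) (U := C ^ 2) (V := C ^ 2) ?_ one_ne_zero hρ
      (by rw [lop_bounceBack, sub_self]) (Or.inr ⟨by simp, by simpa using hr.le, ?_⟩)
    · rw [inv_one]; exact isNull_otherRoot h hC
    · exact stableRootTendsto_one h fun κ' => eq_otherRoot_of_mem h hC
  · obtain ⟨hz, hκ⟩ := hc.norm_le
    have hz0 : z ≠ 0 := norm_pos_iff.1 (by linarith)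
    have hw : ‖z⁻¹‖ ≤ 1 := by rw [norm_inv]; exact inv_le_one_of_one_le₀ hz
    obtain ⟨ρ, U, V, hne, hn, hl⟩ := exists_isNull_of_isCritical hz0 hc
    rw [lop_bounceBack] at hl
    have hz1 : z = 1 := inv_eq_one.1 (hn.eq_one_of_sub_eq_zero h hw hne hl)
    have hκ1 : κ = otherRoot a C := by
      have hden : (((1 + a) * C - (1 - a) : ℝ) : ℂ) ≠ 0 := by
        exact_mod_cast (otherRoot_den h hC).ne
      rw [otherRoot, Complex.ofReal_div, eq_div_iff hden]
      exact hn.kappa_mul_eq_of_sub_eq_zero h hw hne hl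
    exact ⟨by simp [hz1], by simpa [hκ1] using abs_otherRoot_lt h hC⟩

theorem mildlyUnstableExtended_extrapolation (h : Admissible a b C) (hlam : 0 < lam) (hC : 0 < C)
    {σ : ℕ} (hσ : 1 ≤ σ) :
    MildlyUnstableExtended lam C ![s₁, 1 - a, 1 - b] (extrapolation σ) := by
  have hno := not_stronglyStableObserved_extrapolation (s₁ := s₁) h hlam hC hσ
  refine ⟨fun hs => hno (hs.observed hlam), hno, ⟨1, 1, ?_⟩, fun z κ hc => ?_⟩
  · refine IsNull.isCritical (ρ := 2) (U := C ^ 2 + C) (V := C ^ 2 - C) ?_ one_ne_zero two_ne_zero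
      ?_ (Or.inr ⟨by simp, by simp, ?_⟩)
    · rw [inv_one]; exact isNull_one_one a b C
    · rw [lop_extrapolation, sub_self, zero_pow (by omega), zero_mul]
    · exact stableRootTendsto_one h fun κ' => eq_one_of_mem h hC
  · obtain ⟨hz, hκ⟩ := hc.norm_le
    have hz0 : z ≠ 0 := norm_pos_iff.1 (by linarith)
    have hw : ‖z⁻¹‖ ≤ 1 := by rw [norm_inv]; exact inv_le_one_of_one_le₀ hz
    obtain ⟨ρ, U, V, hne, hn, hl⟩ := exists_isNull_of_isCritical hz0 hc
    rw [lop_extrapolation] at hl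
    have h1 := (mul_eq_zero.1 hl).resolve_right (hn.U_ne_zero h hw hκ hne)
    have h2 : κ = 1 := (sub_eq_zero.1 (pow_eq_zero_iff (by omega) |>.1 h1)).symm
    subst h2
    rcases hc.1.1 with h3 | h3
    · exact absurd h3.2 (by simp)
    · exact ⟨h3.1, by simp⟩

end

/-! ### The bound `s₃star` in polynomial form, and the conclusion. -/

/-- The stability condition on `s₃`, in polynomial form. -/
theorem stable_of_le_s₃star {s₂ s₃ : ℝ} (hs₂ : s₂ ∈ Set.Ioo (0 : ℝ) 2)
    (hs₃ : s₃ ∈ Set.Ioo (0 : ℝ) 2) (hstab : s₃ ≤ s₃star s₂) :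
    0 ≤ ((1 - s₂) ^ 2 + 6 * (1 - s₂) + 1) * (1 - (1 - s₃) ^ 2)
      + 4 * (1 - (1 - s₂) ^ 2) * (1 - s₃) := by
  obtain ⟨h1, h2⟩ := hs₂
  obtain ⟨h3, h4⟩ := hs₃
  have hq : 0 < s₂ * (2 - s₂) := mul_pos h1 (by linarith)
  have hsq : Real.sqrt 2 ^ 2 = 2 := Real.sq_sqrt (by norm_num)
  have hs0 := Real.sqrt_nonneg 2
  rw [s₃star] at hstab
  split_ifs at hstab with hx
  · have hT : (1 - s₂) ^ 2 + 6 * (1 - s₂) + 1 = 0 := by rw [hx]; linear_combination 4 * hsq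
    rw [hT]
    have := mul_nonneg hq.le (show 0 ≤ 1 - s₃ by linarith)
    nlinarith
  obtain ⟨T, hT⟩ : ∃ T, T = s₂ ^ 2 - 8 * s₂ + 8 := ⟨_, rfl⟩
  obtain ⟨q, hqd⟩ : ∃ q, q = s₂ * (2 - s₂) := ⟨_, rfl⟩
  obtain ⟨y, hy⟩ : ∃ y, y = s₃ - 1 := ⟨_, rfl⟩
  have hT0 : T ≠ 0 := by
    intro h0
    have : (s₂ - 4 + 2 * Real.sqrt 2) * (s₂ - 4 - 2 * Real.sqrt 2) = 0 := by
      rw [← h0, hT]; linear_combination -4 * hsq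
    rcases mul_eq_zero.1 this with h | h
    · exact hx (by linarith)
    · linarith
  rw [← hT, show 4 * s₂ ^ 2 * (2 - s₂) ^ 2 = 4 * q ^ 2 by rw [hqd]; ring,
    show 2 * s₂ * (2 - s₂) = 2 * q by rw [hqd]; ring] at hstab
  have goal_eq : ((1 - s₂) ^ 2 + 6 * (1 - s₂) + 1) * (1 - (1 - s₃) ^ 2)
      + 4 * (1 - (1 - s₂) ^ 2) * (1 - s₃) = T * (1 - y ^ 2) - 4 * q * y := by
    rw [hT, hqd, hy]; ring
  rw [goal_eq]
  rw [← hqd] at hq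
  -- The bound is a root of the quadratic in the goal: T times the goal is S² - (yT + 2q)², so the
  -- sign of T decides which comparison of squares is needed.
  have hle : y ≤ (Real.sqrt (T ^ 2 + 4 * q ^ 2) - 2 * q) / T := by linarith
  have hS := Real.sq_sqrt (show 0 ≤ T ^ 2 + 4 * q ^ 2 by positivity)
  have hS0 := Real.sqrt_nonneg (T ^ 2 + 4 * q ^ 2)
  set S := Real.sqrt (T ^ 2 + 4 * q ^ 2)
  rcases lt_or_gt_of_ne hT0 with hneg | hpos
  · rw [le_div_iff_of_neg hneg] at hle
    have : S ^ 2 ≤ (y * T + 2 * q) ^ 2 := by gcongr; linarith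
    have h5 : 0 ≤ (-T) * (T * (1 - y ^ 2) - 4 * q * y) := by nlinarith
    exact nonneg_of_mul_nonneg_right h5 (by linarith)
  · rw [le_div_iff₀ hpos] at hle
    -- To the left of the vertex the squares cannot be compared; there -1 < y < 0 already makes both
    -- terms of the goal nonnegative.
    rcases le_or_gt (y * T + 2 * q) 0 with h5 | h5
    · have hy0 : y < 0 := by
        by_contra hy0
        have := mul_nonneg (not_lt.1 hy0) hpos.le
        linarith
      have h6 : 0 ≤ 1 - y ^ 2 := by nlinarith
      have h7 := mul_nonneg hpos.le h6
      have h8 := mul_pos hq (neg_pos.2 hy0)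
      linarith
    · have : (y * T + 2 * q) ^ 2 ≤ S ^ 2 := by gcongr; linarith
      have h5 : 0 ≤ T * (T * (1 - y ^ 2) - 4 * q * y) := by nlinarith
      exact nonneg_of_mul_nonneg_right h5 hpos

end D1Q3

end

theorem mainTheorem3 (lam C s₁ s₂ s₃ : ℝ) (hlam : 0 < lam)
    (hC : C ∈ Set.Ioo (-1 : ℝ) 0 ∪ Set.Ioo (0 : ℝ) 1)
    (hs₂ : s₂ ∈ Set.Ioo (0 : ℝ) 2) (hs₃ : s₃ ∈ Set.Ioo (0 : ℝ) 2)
    (hstab : s₃ ≤ D1Q3.s₃star s₂) :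
    (C < 0 →
      D1Q3.MildlyUnstableLocalized lam C ![s₁, s₂, s₃] D1Q3.bounceBack ∧
      D1Q3.StronglyStable lam C ![s₁, s₂, s₃] D1Q3.antiBounceBack ∧
      D1Q3.StronglyStable lam C ![s₁, s₂, s₃] D1Q3.twoStepsAntiBounceBack ∧
      (∀ σ : ℕ, 1 ≤ σ → σ ≤ 4 →
        D1Q3.StronglyStable lam C ![s₁, s₂, s₃] (D1Q3.extrapolation σ)) ∧
      D1Q3.StronglyStable lam C ![s₁, s₂, s₃] D1Q3.kineticDirichlet) ∧
    (0 < C →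
      D1Q3.StronglyStable lam C ![s₁, s₂, s₃] D1Q3.bounceBack ∧
      D1Q3.StronglyStable lam C ![s₁, s₂, s₃] D1Q3.antiBounceBack ∧
      D1Q3.StronglyStable lam C ![s₁, s₂, s₃] D1Q3.twoStepsAntiBounceBack ∧
      (∀ σ : ℕ, 1 ≤ σ → σ ≤ 4 →
        D1Q3.MildlyUnstableExtended lam C ![s₁, s₂, s₃] (D1Q3.extrapolation σ)) ∧
      D1Q3.StronglyStable lam C ![s₁, s₂, s₃] D1Q3.kineticDirichlet) := by
  have h : D1Q3.Admissible (1 - s₂) (1 - s₃) C := by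
    refine ⟨?_, ?_, ?_, ?_, D1Q3.stable_of_le_s₃star hs₂ hs₃ hstab⟩
    · rw [abs_lt]; constructor <;> linarith [hs₂.1, hs₂.2]
    · rw [abs_lt]; constructor <;> linarith [hs₃.1, hs₃.2]
    · rcases hC with hC | hC
      exacts [hC.2.ne, hC.1.ne']
    · rw [sq_lt_one_iff_abs_lt_one, abs_lt]
      rcases hC with hC | hC <;> constructor <;> linarith [hC.1, hC.2]
  have e : ![s₁, s₂, s₃] = ![s₁, 1 - (1 - s₂), 1 - (1 - s₃)] := by simp
  rw [e]
  exact ⟨fun hC => ⟨D1Q3.mildlyUnstableLocalized_bounceBack h hlam hC,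
      D1Q3.stronglyStable_antiBounceBack h hlam, D1Q3.stronglyStable_twoStepsAntiBounceBack h hlam,
      fun σ _ _ => D1Q3.stronglyStable_extrapolation h hlam hC σ,
      D1Q3.stronglyStable_kineticDirichlet h hlam⟩,
    fun hC => ⟨D1Q3.stronglyStable_bounceBack h hlam hC,
      D1Q3.stronglyStable_antiBounceBack h hlam, D1Q3.stronglyStable_twoStepsAntiBounceBack h hlam,
      fun σ hσ _ => D1Q3.mildlyUnstableExtended_extrapolation h hlam hC hσ,
      D1Q3.stronglyStable_kineticDirichlet h hlam⟩⟩
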